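/- Let $M,N,K,L\ge 1$ be integers with $K\ge M$. Let $\mathbf R\in\mathbb C^{M\times M}$ be Hermitian positive definite with eigendecomposition $\mathbf R=\mathbf U\,\mathrm{diag}\{\lambda_1,\dots,\lambda_M\}\,\mathbf U^{\mathsf H}$, $\mathbf U$ unitary. Let $\mathbf H_1,\dots,\mathbf H_M\in\mathbb C^{K\times M}$ be random matrices all of whose entries are i.i.d. $\mathcal{CN}(0,1)$. Let $\mathbf v_m=\mathbf q_m/\lVert\mathbf q_m\rVert$, where $\mathbf q_m$ is the $m$-th column of $\mathbf P_m(\mathbf P_m^{\mathsf H}\mathbf P_m)^{-1}$ with $\mathbf P_m=\mathbf H_m\mathbf U$, and let $\rho_m=|\mathbf v_m^{\mathsf H}\mathbf h_m|^2$, where $\mathbf h_m$ is the $m$-th column of $\mathbf H_m\mathbf U$. For a precoding matrix $\mathbf W\in\mathbb C^{M\times M}$ let the sensing rate be $\mathcal R_{\rm s}(\mathbf W)=\frac NL\log_2\det(\mathbf I_M+L\mathbf W^{\mathsf H}\mathbf R\mathbf W)$. For $p>0$ the communications-centric design uses $\mathbf W_{\rm c}=\mathbf U\,\mathrm{diag}\{c_1^\star,\dots,c_M^\star\}^{1/2}$,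 where $(c_m^\star)_m$ maximizes $\sum_{m=1}^M\log_2(1+c_m\rho_m)$ subject to $c_m\ge0$ and $\sum_{m=1}^M c_m\le p$. Almost surely, this maximizer is given by $c_m^\star=\max\{0,\frac1\upsilon-\frac1{\rho_m}\}$ for some $\upsilon>0$, with $\sum_{m=1}^M c_m^\star=p$, and $\mathcal R_{\rm s}(\mathbf W_{\rm c})=\frac NL\sum_{m=1}^M\log_2(1+L\lambda_mc_m^\star)$. The average sensing rate $\mathcal R_{\rm s}^{\rm c}(p)=\mathbb E\{\mathcal R_{\rm s}(\mathbf W_{\rm c})\}$ is finite for every $p>0$ and $$\mathcal R_{\rm s}^{\rm c}(p)-\frac{NM}{L}\Big(\log_2p+\frac1M\sum_{m=1}^M\log_2\frac{L\lambda_m}{M}\Big)\longrightarrow0\qquad(p\to\infty).$$ This is the same high-SNR slope and offset as for the sensing-centric optimum: the maximum $\mathcal R_{\rm s}^{\rm s}(p)=\max\{\mathcal R_{\rm s}(\mathbf W):\mathrm{tr}(\mathbf W\mathbf W^{\mathsf H})\le p\}$ exists for every $p>0$, and $$\mathcal R_{\rm s}^{\rm s}(p)-\frac{NM}{L}\Big(\log_2p+\frac1M\sum_{m=1}^M\log_2\frac{L\lambda_m}{M}\Big)\longrightarrow0\qquad(p\to\infty).$$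 -/

import Mathlib

open MeasureTheory ProbabilityTheory Filter Topology

open scoped Matrix ComplexOrder

noncomputable section

namespace ISAC

/-- The circularly symmetric complex Gaussian law `CN(0, 1)`: independent real and imaginary
parts, each centred with variance `1/2`. -/
def stdComplexGaussian : Measure ℂ :=
  ((gaussianReal 0 (1 / 2)).prod (gaussianReal 0 (1 / 2))).map
    (fun z : ℝ × ℝ => (⟨z.1, z.2⟩ : ℂ))

/-- Rayleigh fading for the `M` channel matrices `H₁, …, H_M ∈ ℂ^{K × M}`: all entries of all the
matrices are i.i.d. `CN(0, 1)`. -/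
structure IsRayleigh {Ω : Type*} [MeasurableSpace Ω] {M K : ℕ}
    (H : Fin M → Ω → Matrix (Fin K) (Fin M) ℂ) (μ : Measure Ω) : Prop where
  law : ∀ m i j, HasLaw (fun ω => H m ω i j) stdComplexGaussian μ
  indep : iIndepFun (fun (x : Fin M × Fin K × Fin M) ω => H x.1 ω x.2.1 x.2.2) μ

/-- The vector `q_m`: the `m`-th column of `A (Aᴴ A)⁻¹`, for the effective channel
`A = H_m P ∈ ℂ^{K × M}` of user `m`. -/
def zfVector {M K : ℕ} (A : Matrix (Fin K) (Fin M) ℂ) (m : Fin M) : Fin K → ℂ :=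
  fun k => (A * (Aᴴ * A)⁻¹) k m

/-- The normalized equalizer `v_m = q_m / ‖q_m‖` (Euclidean norm). -/
def equalizer {M K : ℕ} (A : Matrix (Fin K) (Fin M) ℂ) (m : Fin M) : Fin K → ℂ :=
  ((‖WithLp.toLp 2 (zfVector A m)‖⁻¹ : ℝ) : ℂ) • zfVector A m

/-- The effective channel gain `ρ_m = |v_mᴴ h_m|²` with `h_m` the `m`-th column of the effective
channel `A = H_m P` of user `m`. -/
def channelGain {M K : ℕ} (A : Matrix (Fin K) (Fin M) ℂ) (m : Fin M) : ℝ :=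
  ‖star (equalizer A m) ⬝ᵥ (fun k => A k m)‖ ^ 2

/-- The channel gains `(ρ_1, …, ρ_M)` for the channels `H_1, …, H_M` and the precoder `P`. -/
def gains {M K : ℕ} (H : Fin M → Matrix (Fin K) (Fin M) ℂ) (P : Matrix (Fin M) (Fin M) ℂ) :
    Fin M → ℝ :=
  fun m => channelGain (H m * P) m

/-- Power allocations within the budget `p`. -/
def powerAllocations (M : ℕ) (p : ℝ) : Set (Fin M → ℝ) :=
  {c | (∀ m, 0 ≤ c m) ∧ ∑ m, c m ≤ p}

/-- The sum communication rate `∑ log₂ (1 + c_m ρ_m)`. -/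
def sumCommRate {M : ℕ} (ρ c : Fin M → ℝ) : ℝ :=
  ∑ m, Real.logb 2 (1 + c m * ρ m)

/-- `c` is a communications-centric power allocation: it maximizes the sum communication rate
within the power budget `p`. -/
def IsCommOptimal {M : ℕ} (ρ : Fin M → ℝ) (p : ℝ) (c : Fin M → ℝ) : Prop :=
  c ∈ powerAllocations M p ∧ IsMaxOn (sumCommRate ρ) (powerAllocations M p) c

/-- The precoding matrix `P diag(c)^{1/2}`. -/
def precoder {M : ℕ} (P : Matrix (Fin M) (Fin M) ℂ) (c : Fin M → ℝ) : Matrix (Fin M) (Fin M) ℂ :=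
  P * Matrix.diagonal (fun m => ((Real.sqrt (c m) : ℝ) : ℂ))

/-- The sensing rate `(N / L) log₂ det (I + L Wᴴ R W)` of the precoding matrix `W`
(the determinant is a real number when `R` is Hermitian). -/
def sensingRate {M : ℕ} (N L : ℕ) (R W : Matrix (Fin M) (Fin M) ℂ) : ℝ :=
  (N : ℝ) / L * Real.logb 2 (1 + (L : ℂ) • (Wᴴ * R * W)).det.re

/-- The sensing rates of all precoding matrices with `tr (W Wᴴ) ≤ p`. -/
def achievableSensingRates {M : ℕ} (N L : ℕ) (R : Matrix (Fin M) (Fin M) ℂ) (p : ℝ) : Set ℝ :=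
  sensingRate N L R '' {W | (W * Wᴴ).trace.re ≤ p}

/-- The sensing-centric optimum: the maximum sensing rate under the power budget `p`. -/
def maxSensingRate {M : ℕ} (N L : ℕ) (R : Matrix (Fin M) (Fin M) ℂ) (p : ℝ) : ℝ :=
  sSup (achievableSensingRates N L R p)

/-- The high-SNR expression `(N M / L) (log₂ p + (1 / M) ∑ log₂ (L λ_m / M))`. -/
def highSNRSensingRate {M : ℕ} (N L : ℕ) (lam : Fin M → ℝ) (p : ℝ) : ℝ :=
  (N : ℝ) * M / L *
    (Real.logb 2 p + 1 / (M : ℝ) * ∑ m, Real.logb 2 ((L : ℝ) * lam m / M))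

end ISAC

end

/-! When all gains are positive, shifting power from a user with a higher level `1/ρ + c` to one
with a lower level raises the sum rate. The maximizer is therefore `c_m = max 0 (w - 1/ρ_m)`, with
`w` fixed by the budget (`IsCommOptimal.eq_max`, `waterLevel_eq`). The level satisfies `p/M ≤ w ≤ (p
+ ∑ 1/ρ_m)/M`, hence `c_m/p → 1/M` for each such channel, and each user's rate minus its high-SNR
expression tends to zero almost surely.

Passing to the mean uses dominated convergence (`IsRayleigh.tendsto_integral_logb`). Since `c_m ≥
p/M - 1/ρ_m`, either `1/ρ_m ≤ p/(2M)` and the deviation is bounded, or `p < 2M/ρ_m` and it is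
bounded by a constant plus a nonnegative bound on `log (1/ρ_m)` (`abs_logb_one_add_sub_le`). It
remains to find such a bound with finite mean. Now `1/ρ_m = ‖q_m‖²`, and `q_m` is the shortest
solution of `Aᴴ x = e_m`. A solution supported on the first `M` coordinates gives a bound by entries
of `A` and `1/|det|` of its leading square block (`one_div_channelGain_le`). That determinant is a
nonzero polynomial in independent Gaussians, and the negative part of its logarithm is integrable
(`lintegral_negLog_mvPolynomial_ne_top`): eliminate one variable at a time, factoring over `ℂ`.

For the sensing optimum, `det (I + L Wᴴ R W) = det R · det (R⁻¹ + L W Wᴴ)` and the AM-GM inequality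
give an upper bound; equal power along `U` gives a matching lower bound. -/

/-! ### Water-filling -/

section WaterFilling

variable {ι : Type*} [Fintype ι]

/-- The water level: the solution `w` of `∑ max 0 (w - a i) = p`, as a minimum over the possible
sets of active indices. -/
noncomputable def waterLevel (a : ι → ℝ) (p : ℝ) : ℝ :=
  ⨅ S : {S : Finset ι // S.Nonempty}, (p + ∑ i ∈ S.1, a i) / (S.1.card : ℝ)

/-- Every nonempty `S` has `∑_{i ∈ S} (w - a i) ≤ p`, so its quotient is at least `w`, and the
active set `{a i < w}` attains equality. The level is thus unique, and as a finite minimum of affine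
functions of `a` it is measurable in `a`. -/
theorem waterLevel_eq {a : ι → ℝ} {p w : ℝ} (hp : 0 < p)
    (h : ∑ i, max 0 (w - a i) = p) : waterLevel a p = w := by
  classical
  have hle : ∀ S : {S : Finset ι // S.Nonempty}, w ≤ (p + ∑ i ∈ S.1, a i) / (S.1.card : ℝ) := by
    rintro ⟨S, hS⟩
    have hc : (0 : ℝ) < S.card := by exact_mod_cast hS.card_pos
    rw [le_div_iff₀ hc]
    have h1 : ∑ i ∈ S, (w - a i) ≤ ∑ i ∈ S, max 0 (w - a i) :=
      Finset.sum_le_sum fun i _ => le_max_right _ _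
    have h2 : ∑ i ∈ S, max 0 (w - a i) ≤ ∑ i, max 0 (w - a i) :=
      Finset.sum_le_sum_of_subset_of_nonneg (Finset.subset_univ _) fun i _ _ => le_max_left _ _
    rw [Finset.sum_sub_distrib, Finset.sum_const, nsmul_eq_mul] at h1
    linarith
  set A : Finset ι := Finset.univ.filter fun i => a i < w with hA
  have hsum : ∑ i ∈ A, (w - a i) = p := by
    rw [← h, hA, Finset.sum_filter]
    refine Finset.sum_congr rfl fun i _ => ?_
    split_ifs with hi
    · rw [max_eq_right (by linarith)]
    · rw [max_eq_left (by linarith)]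
  have hne : A.Nonempty := by
    rw [Finset.nonempty_iff_ne_empty]
    intro h0
    rw [h0, Finset.sum_empty] at hsum
    linarith
  have hc : (0 : ℝ) < A.card := by exact_mod_cast hne.card_pos
  have hAw : (p + ∑ i ∈ A, a i) / (A.card : ℝ) = w := by
    rw [div_eq_iff hc.ne']
    rw [Finset.sum_sub_distrib, Finset.sum_const, nsmul_eq_mul] at hsum
    linarith
  have : Nonempty {S : Finset ι // S.Nonempty} := ⟨⟨A, hne⟩⟩
  refine le_antisymm ?_ (le_ciInf hle)
  exact (ciInf_le (Set.finite_range _).bddBelow ⟨A, hne⟩).trans hAw.le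

theorem sum_waterLevel [Nonempty ι] (a : ι → ℝ) {p : ℝ} (hp : 0 < p) :
    ∑ i, max 0 (waterLevel a p - a i) = p := by
  classical
  obtain ⟨w, hw⟩ : ∃ w, ∑ i, max 0 (w - a i) = p := by
    have hcont : Continuous fun w => ∑ i, max 0 (w - a i) := by fun_prop
    obtain ⟨i₀⟩ := ‹Nonempty ι›
    -- The point `-∑ |a i|` lies at or below every `a i`, so no index is active there.
    have hlo : ∑ i, max 0 ((-∑ i, |a i|) - a i) = 0 := by
      refine Finset.sum_eq_zero fun i _ => max_eq_left ?_
      have : |a i| ≤ ∑ i, |a i| := Finset.single_le_sum (f := fun i => |a i|)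
        (fun i _ => abs_nonneg _) (Finset.mem_univ i)
      linarith [neg_abs_le (a i)]
    have hhi : p ≤ ∑ i, max 0 ((a i₀ + p) - a i) := by
      have := Finset.single_le_sum (f := fun i => max 0 ((a i₀ + p) - a i))
        (fun i _ => le_max_left _ _) (Finset.mem_univ i₀)
      refine le_trans ?_ this
      simp
    exact mem_range_of_exists_le_of_exists_ge hcont ⟨_, hlo.le.trans hp.le⟩ ⟨_, hhi⟩
  rwa [waterLevel_eq hp hw]

/-- As `a ≥ 0`, no summand exceeds the level. Together with `waterLevel_le`, which takes the full
index set as competitor, this locates the level within a `p`-independent distance of `p / card ι`.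
-/
theorem div_card_le_waterLevel [Nonempty ι] {a : ι → ℝ} (ha : ∀ i, 0 ≤ a i) {p : ℝ} (hp : 0 < p) :
    p / Fintype.card ι ≤ waterLevel a p := by
  have hc : (0 : ℝ) < Fintype.card ι := by exact_mod_cast Fintype.card_pos
  have h := sum_waterLevel a hp
  have hw : 0 ≤ waterLevel a p := by
    by_contra! hneg
    rw [Finset.sum_eq_zero fun i _ => max_eq_left (by linarith [ha i])] at h
    exact hp.ne h
  rw [div_le_iff₀ hc]
  calc p = ∑ i, max 0 (waterLevel a p - a i) := h.symm
    _ ≤ ∑ _i : ι, waterLevel a p :=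
        Finset.sum_le_sum fun i _ => max_le hw (by linarith [ha i])
    _ = waterLevel a p * Fintype.card ι := by simp [mul_comm]

theorem waterLevel_le [Nonempty ι] (a : ι → ℝ) (p : ℝ) :
    waterLevel a p ≤ (p + ∑ i, a i) / Fintype.card ι :=
  ciInf_le (Set.finite_range _).bddBelow
    (⟨Finset.univ, Finset.univ_nonempty⟩ : {S : Finset ι // S.Nonempty})

theorem aemeasurable_waterLevel {Ω : Type*} [MeasurableSpace Ω] {μ : Measure Ω}
    {a : Ω → ι → ℝ} (ha : ∀ i, AEMeasurable (fun ω => a ω i) μ) (p : ℝ) :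
    AEMeasurable (fun ω => waterLevel (a ω) p) μ := by
  unfold waterLevel
  refine AEMeasurable.iInf fun S => ?_
  exact ((Finset.aemeasurable_fun_sum _ fun i _ => ha i).const_add p).div_const _

end WaterFilling

namespace ISAC

theorem mul_one_add_mul_eq {ρ c : ℝ} (hρ : 0 < ρ) : 1 + c * ρ = ρ * (1 / ρ + c) := by
  field_simp

/-- Transferring power from user `m` to user `n` does not pay off at an optimal allocation. -/
theorem IsCommOptimal.level_le {M : ℕ} {ρ : Fin M → ℝ} (hρ : ∀ m, 0 < ρ m) {p : ℝ}
    {c : Fin M → ℝ} (h : IsCommOptimal ρ p c) {m n : Fin M} (hm : 0 < c m) :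
    1 / ρ m + c m ≤ 1 / ρ n + c n := by
  by_contra! hlt
  have hmn : m ≠ n := by rintro rfl; exact lt_irrefl _ hlt
  obtain ⟨⟨h0, hs⟩, hmax⟩ := h
  set x := 1 / ρ m + c m with hx
  set y := 1 / ρ n + c n with hy
  -- `ε ≤ c m` keeps the new allocation nonnegative, and `ε < x - y` makes `(x - ε)(y + ε) - x y = ε
  -- (x - y - ε)` positive.
  obtain ⟨ε, hε, hεm, hεg⟩ : ∃ ε, 0 < ε ∧ ε ≤ c m ∧ ε < x - y :=
    ⟨min (c m) ((x - y) / 2), lt_min hm (by linarith), min_le_left _ _,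
      (min_le_right _ _).trans_lt (by linarith)⟩
  have hsplit : ∀ g : Fin M → ℝ, ∑ i, g i = g m + g n + ∑ i ∈ ({m, n} : Finset (Fin M))ᶜ, g i := by
    intro g
    rw [← Finset.sum_add_sum_compl {m, n}, Finset.sum_pair hmn]
  set d : Fin M → ℝ := fun i => if i = m then c m - ε else if i = n then c n + ε else c i with hd
  have hdm : d m = c m - ε := by simp [hd]
  have hdn : d n = c n + ε := by simp [hd, hmn.symm]
  have hdo : ∀ i ∈ ({m, n} : Finset (Fin M))ᶜ, d i = c i := by
    intro i hi
    simp only [Finset.mem_compl, Finset.mem_insert, Finset.mem_singleton, not_or] at hi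
    simp [hd, hi.1, hi.2]
  have hmem : d ∈ powerAllocations M p := by
    refine ⟨fun i => ?_, ?_⟩
    · by_cases him : i = m
      · rw [him, hdm]; linarith
      · by_cases hin : i = n
        · rw [hin, hdn]; linarith [h0 n]
        · simpa [hd, him, hin] using h0 i
    · rw [hsplit, hdm, hdn, Finset.sum_congr rfl hdo]
      rw [hsplit] at hs
      linarith
  have hle : sumCommRate ρ d ≤ sumCommRate ρ c := hmax hmem
  unfold sumCommRate at hle
  rw [hsplit, hsplit (fun i => Real.logb 2 (1 + c i * ρ i)), hdm, hdn,
    Finset.sum_congr rfl fun i hi => by rw [hdo i hi]] at hle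
  have hρm := one_div_pos.2 (hρ m)
  have hρn := one_div_pos.2 (hρ n)
  have hpos : ∀ i {t : ℝ}, 0 ≤ t → 0 < 1 + t * ρ i := fun i t ht => by
    have := mul_nonneg ht (hρ i).le
    linarith
  have p1 := hpos m (t := c m - ε) (by linarith)
  have p2 := hpos n (t := c n + ε) (by linarith [h0 n])
  have p3 := hpos m (h0 m)
  have p4 := hpos n (h0 n)
  have hle' : Real.logb 2 ((1 + (c m - ε) * ρ m) * (1 + (c n + ε) * ρ n)) ≤
      Real.logb 2 ((1 + c m * ρ m) * (1 + c n * ρ n)) := by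
    rw [Real.logb_mul p1.ne' p2.ne', Real.logb_mul p3.ne' p4.ne']
    linarith
  rw [Real.logb_le_logb one_lt_two (mul_pos p1 p2) (mul_pos p3 p4)] at hle'
  have e1 : (1 + (c m - ε) * ρ m) * (1 + (c n + ε) * ρ n) = ρ m * ρ n * ((x - ε) * (y + ε)) := by
    rw [mul_one_add_mul_eq (hρ m), mul_one_add_mul_eq (hρ n)]; ring
  have e2 : (1 + c m * ρ m) * (1 + c n * ρ n) = ρ m * ρ n * (x * y) := by
    rw [mul_one_add_mul_eq (hρ m), mul_one_add_mul_eq (hρ n)]; ring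
  rw [e1, e2] at hle'
  have := le_of_mul_le_mul_left hle' (mul_pos (hρ m) (hρ n))
  nlinarith [mul_pos hε (sub_pos.2 hεg)]

/-- The optimal allocation exhausts the power budget. -/
theorem IsCommOptimal.sum_eq {M : ℕ} (hM : 0 < M) {ρ : Fin M → ℝ} (hρ : ∀ m, 0 < ρ m) {p : ℝ}
    {c : Fin M → ℝ} (h : IsCommOptimal ρ p c) : ∑ m, c m = p := by
  obtain ⟨⟨h0, hs⟩, hmax⟩ := h
  refine le_antisymm hs (le_of_not_gt fun hlt => ?_)
  have hMR : (0 : ℝ) < M := by exact_mod_cast hM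
  set δ := (p - ∑ m, c m) / M with hδ
  have hδ0 : 0 < δ := div_pos (by linarith) hMR
  have hmem : (fun m => c m + δ) ∈ powerAllocations M p := by
    refine ⟨fun m => by linarith [h0 m], ?_⟩
    rw [Finset.sum_add_distrib, Finset.sum_const, Finset.card_univ, Fintype.card_fin, nsmul_eq_mul,
      hδ, mul_div_cancel₀ _ hMR.ne']
    linarith
  have hle : sumCommRate ρ (fun m => c m + δ) ≤ sumCommRate ρ c := hmax hmem
  refine absurd hle (not_le.2 ?_)
  refine Finset.sum_lt_sum_of_nonempty ⟨⟨0, hM⟩, Finset.mem_univ _⟩ fun m _ => ?_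
  have := mul_nonneg (h0 m) (hρ m).le
  have := mul_pos hδ0 (hρ m)
  exact Real.logb_lt_logb one_lt_two (by linarith) (by linarith)

/-- The maximizer of the sum communication rate is given by water-filling. -/
theorem IsCommOptimal.eq_max {M : ℕ} (hM : 0 < M) {ρ : Fin M → ℝ} (hρ : ∀ m, 0 < ρ m) {p : ℝ}
    (hp : 0 < p) {c : Fin M → ℝ} (h : IsCommOptimal ρ p c) :
    ∃ w : ℝ, 0 < w ∧ ∀ m, c m = max 0 (w - 1 / ρ m) := by
  have hsum := h.sum_eq hM hρ
  obtain ⟨m₀, hm₀⟩ : ∃ m, 0 < c m := by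
    by_contra! hcon
    have := Finset.sum_nonpos fun m (_ : m ∈ Finset.univ) => hcon m
    linarith
  -- The level of any active user serves: active users compare both ways, and an inactive one has `1
  -- / ρ m` at or above it.
  refine ⟨1 / ρ m₀ + c m₀, add_pos (one_div_pos.2 (hρ m₀)) hm₀, fun m => ?_⟩
  have h1 := h.level_le hρ (n := m) hm₀
  rcases (h.1.1 m).eq_or_lt with hm | hm
  · rw [max_eq_left (by linarith), hm]
  · have h2 := h.level_le hρ (n := m₀) hm
    rw [max_eq_right (by linarith)]
    linarith

end ISAC

/-! ### Zero forcing -/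

namespace ISAC

section ZeroForcing

variable {M K : ℕ} {A : Matrix (Fin K) (Fin M) ℂ}

theorem zfVector_eq_mulVec (A : Matrix (Fin K) (Fin M) ℂ) (m : Fin M) :
    zfVector A m = A *ᵥ ((Aᴴ * A)⁻¹ *ᵥ Pi.single m 1) := by
  rw [Matrix.mulVec_mulVec, Matrix.mulVec_single_one]
  rfl

theorem conjTranspose_mulVec_zfVector (hA : IsUnit (Aᴴ * A).det) (m : Fin M) :
    Aᴴ *ᵥ zfVector A m = Pi.single m 1 := by
  rw [zfVector_eq_mulVec, Matrix.mulVec_mulVec, Matrix.mulVec_mulVec, Matrix.mul_nonsing_inv _ hA,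
    Matrix.one_mulVec]

/-- The inner product of the zero-forcing vector with any other solution of `Aᴴ x = e_m` does
not depend on the solution. -/
theorem star_zfVector_dotProduct {m : Fin M} {x : Fin K → ℂ} (hx : Aᴴ *ᵥ x = Pi.single m 1) :
    star (zfVector A m) ⬝ᵥ x = star ((Aᴴ * A)⁻¹ *ᵥ Pi.single m 1) ⬝ᵥ Pi.single m 1 := by
  rw [zfVector_eq_mulVec, Matrix.star_mulVec, ← Matrix.dotProduct_mulVec, hx]

theorem star_dotProduct_self (x : Fin K → ℂ) :
    star x ⬝ᵥ x = ((‖WithLp.toLp 2 x‖ ^ 2 : ℝ) : ℂ) := by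
  rw [EuclideanSpace.norm_sq_eq, dotProduct]
  push_cast
  refine Finset.sum_congr rfl fun i _ => ?_
  simpa using Complex.conj_mul' (x i)

theorem norm_star_dotProduct_le (x y : Fin K → ℂ) :
    ‖star x ⬝ᵥ y‖ ≤ ‖WithLp.toLp 2 x‖ * ‖WithLp.toLp 2 y‖ := by
  have := norm_inner_le_norm (𝕜 := ℂ) (WithLp.toLp 2 x) (WithLp.toLp 2 y)
  rwa [EuclideanSpace.inner_toLp_toLp, dotProduct_comm] at this

/-- The zero-forcing vector lies in the range of `A`, so its inner product with any solution equals
its own squared norm; Cauchy–Schwarz then makes it the shortest solution. -/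
theorem norm_zfVector_le (hA : IsUnit (Aᴴ * A).det) {m : Fin M} {x : Fin K → ℂ}
    (hx : Aᴴ *ᵥ x = Pi.single m 1) :
    ‖WithLp.toLp 2 (zfVector A m)‖ ≤ ‖WithLp.toLp 2 x‖ := by
  have h := norm_star_dotProduct_le (zfVector A m) x
  rw [star_zfVector_dotProduct hx,
    ← star_zfVector_dotProduct (conjTranspose_mulVec_zfVector hA m), star_dotProduct_self,
    Complex.norm_real, Real.norm_of_nonneg (by positivity), sq] at h
  rcases (norm_nonneg (WithLp.toLp 2 (zfVector A m))).eq_or_lt with h0 | h0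
  · rw [← h0]; positivity
  · exact le_of_mul_le_mul_left h h0

theorem norm_zfVector_pos (hA : IsUnit (Aᴴ * A).det) (m : Fin M) :
    0 < ‖WithLp.toLp 2 (zfVector A m)‖ := by
  rw [norm_pos_iff]
  intro h0
  have hq : zfVector A m = 0 := by simpa using h0
  have := conjTranspose_mulVec_zfVector hA m
  rw [hq, Matrix.mulVec_zero] at this
  simpa using congrFun this m

theorem channelGain_eq (hA : IsUnit (Aᴴ * A).det) (m : Fin M) :
    channelGain A m = 1 / ‖WithLp.toLp 2 (zfVector A m)‖ ^ 2 := by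
  have h1 : star (zfVector A m) ⬝ᵥ (fun k => A k m) = 1 := by
    have h := congrFun (conjTranspose_mulVec_zfVector hA m) m
    rw [Pi.single_eq_same] at h
    have h' := congrArg star h
    rw [star_one] at h'
    rw [← h']
    simp [Matrix.mulVec, dotProduct, mul_comm]
  unfold channelGain equalizer
  rw [star_smul, smul_dotProduct, h1]
  simp

theorem channelGain_pos (hA : IsUnit (Aᴴ * A).det) (m : Fin M) : 0 < channelGain A m := by
  rw [channelGain_eq hA]
  have := norm_zfVector_pos hA m
  positivity

end ZeroForcing

/-! ### Bounding the reciprocal gain through the leading square block of the channel. -/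

section Bound

variable {M K : ℕ} (hK : M ≤ K)

/-- The square matrix formed by the first `M` rows. -/
def topBlock (A : Matrix (Fin K) (Fin M) ℂ) : Matrix (Fin M) (Fin M) ℂ :=
  A.submatrix (Fin.castLE hK) id

/-- The first `M` rows already separate vectors, so `A` is injective and its Gram matrix positive
definite. -/
theorem isUnit_det_of_topBlock {A : Matrix (Fin K) (Fin M) ℂ} (h : (topBlock hK A).det ≠ 0) :
    IsUnit (Aᴴ * A).det := by
  refine (Matrix.PosDef.conjTranspose_mul_self A ?_).det_pos.ne'.isUnit
  have hinj := Matrix.mulVec_injective_of_isUnit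
    ((Matrix.isUnit_iff_isUnit_det _).2 h.isUnit)
  intro x y hxy
  refine hinj ?_
  funext i
  exact congrFun hxy (Fin.castLE hK i)

theorem topBlock_mul (A : Matrix (Fin K) (Fin M) ℂ) (B : Matrix (Fin M) (Fin M) ℂ) :
    topBlock hK (A * B) = topBlock hK A * B := rfl

/-- A vector on the first `M` coordinates, extended by zero. -/
def extendZero (K : ℕ) (x : Fin M → ℂ) : Fin K → ℂ :=
  fun k => if h : (k : ℕ) < M then x ⟨k, h⟩ else 0

theorem sum_extendZero (hK : M ≤ K) {E : Type*} [AddCommMonoid E] (f : Fin K → E)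
    (hf : ∀ k : Fin K, ¬ (k : ℕ) < M → f k = 0) :
    ∑ k, f k = ∑ i : Fin M, f (Fin.castLE hK i) := by
  refine (Finset.sum_of_injOn (Fin.castLE hK) (Fin.castLE_injective hK).injOn (by simp) ?_
    (fun _ _ => rfl)).symm
  intro k _ hk
  refine hf k fun hlt => hk ?_
  exact ⟨⟨k, hlt⟩, by simp, rfl⟩

theorem conjTranspose_mulVec_extendZero (A : Matrix (Fin K) (Fin M) ℂ) (x : Fin M → ℂ) :
    Aᴴ *ᵥ extendZero K x = (topBlock hK A)ᴴ *ᵥ x := by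
  funext j
  simp only [Matrix.mulVec, dotProduct]
  rw [sum_extendZero hK]
  · simp [extendZero, topBlock]
  · intro k hk
    simp [extendZero, hk]

theorem norm_extendZero_sq (hK : M ≤ K) (x : Fin M → ℂ) :
    ‖WithLp.toLp 2 (extendZero K x)‖ ^ 2 = ∑ i, ‖x i‖ ^ 2 := by
  rw [EuclideanSpace.norm_sq_eq, sum_extendZero hK]
  · simp [extendZero]
  · intro k hk
    simp [extendZero, hk]

/-- The entry is the determinant of `B` with one row replaced by a unit vector; `1 ≤ X` keeps the
new row within the entry bound. -/
theorem norm_adjugate_apply_le {n : ℕ} (B : Matrix (Fin n) (Fin n) ℂ) {X : ℝ} (hX : 1 ≤ X)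
    (hB : ∀ i j, ‖B i j‖ ≤ X) (i j : Fin n) : ‖B.adjugate i j‖ ≤ n.factorial * X ^ n := by
  rw [Matrix.adjugate_apply]
  have := Matrix.det_le (A := B.updateRow j (Pi.single i 1))
    (abv := (⟨⟨(‖·‖), norm_mul⟩, norm_nonneg, fun _ => norm_eq_zero, norm_add_le⟩ :
      AbsoluteValue ℂ ℝ)) (x := X) fun k l => ?_
  · rwa [Fintype.card_fin, nsmul_eq_mul] at this
  · change ‖B.updateRow j (Pi.single i 1) k l‖ ≤ X
    rw [Matrix.updateRow_apply]
    split_ifs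
    · rw [Pi.single_apply]
      split_ifs
      · simpa using hX
      · simpa using zero_le_one.trans hX
    · exact hB k l

/-- The reciprocal of the channel gain is bounded through the first `M` rows of the channel. -/
theorem one_div_channelGain_le {A : Matrix (Fin K) (Fin M) ℂ} (h : (topBlock hK A).det ≠ 0)
    {X : ℝ} (hX : 1 ≤ X) (hA : ∀ i j, ‖A i j‖ ≤ X) (m : Fin M) :
    1 / channelGain A m ≤ M * (M.factorial * X ^ M / ‖(topBlock hK A).det‖) ^ 2 := by
  have hu := isUnit_det_of_topBlock hK h
  set T := topBlock hK A with hT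
  have hdet : IsUnit (Tᴴ).det := by
    rw [Matrix.det_conjTranspose]
    exact (star_ne_zero.2 h).isUnit
  -- The competitor for the shortest solution: solve the square system and extend by zero. Its
  -- entries are adjugate entries over `det T`.
  set x : Fin M → ℂ := (Tᴴ)⁻¹ *ᵥ Pi.single m 1 with hx
  have hsol : Aᴴ *ᵥ extendZero K x = Pi.single m 1 := by
    rw [conjTranspose_mulVec_extendZero hK, ← hT, hx, Matrix.mulVec_mulVec,
      Matrix.mul_nonsing_inv _ hdet, Matrix.one_mulVec]
  have hle := norm_zfVector_le hu hsol
  rw [channelGain_eq hu, one_div_one_div]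
  calc ‖WithLp.toLp 2 (zfVector A m)‖ ^ 2
      ≤ ‖WithLp.toLp 2 (extendZero K x)‖ ^ 2 := by gcongr
    _ = ∑ i, ‖x i‖ ^ 2 := norm_extendZero_sq hK x
    _ ≤ ∑ _i : Fin M, (M.factorial * X ^ M / ‖T.det‖) ^ 2 := by
        refine Finset.sum_le_sum fun i _ => ?_
        gcongr
        have : x i = star (T.det⁻¹ * T.adjugate m i) := by
          rw [hx, Matrix.mulVec_single_one, Matrix.col_apply, ← Matrix.conjTranspose_nonsing_inv,
            Matrix.conjTranspose_apply, Matrix.inv_def]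
          simp
        rw [this, norm_star, norm_mul, norm_inv, inv_mul_eq_div]
        gcongr
        exact norm_adjugate_apply_le T hX (fun i j => hA _ _) m i
    _ = _ := by simp

theorem norm_mul_unitary_apply_le (A : Matrix (Fin K) (Fin M) ℂ) {U : Matrix (Fin M) (Fin M) ℂ}
    (hU : U ∈ Matrix.unitaryGroup (Fin M) ℂ) (i : Fin K) (j : Fin M) :
    ‖(A * U) i j‖ ≤ ∑ k, ‖A i k‖ := by
  rw [Matrix.mul_apply]
  refine (norm_sum_le _ _).trans (Finset.sum_le_sum fun k _ => ?_)
  rw [norm_mul]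
  exact mul_le_of_le_one_right (norm_nonneg _) (entry_norm_bound_of_unitary hU k j)

end Bound

end ISAC

/-! ### Logarithmic integrability of polynomials -/

open Classical in
/-- The negative part of `log ‖z‖`, with value `∞` at `z = 0`. -/
noncomputable def negLog {E : Type*} [NormedAddCommGroup E] (z : E) : ENNReal :=
  if z = 0 then ⊤ else ENNReal.ofReal (-Real.log ‖z‖)

/-- The value `⊤` at zero makes this hold without exceptions; it also lets a finite integral imply
nonvanishing almost everywhere. -/
theorem negLog_mul_le (z w : ℂ) : negLog (z * w) ≤ negLog z + negLog w := by
  unfold negLog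
  by_cases hz : z = 0
  · simp [hz]
  by_cases hw : w = 0
  · simp [hw]
  rw [if_neg (mul_ne_zero hz hw), if_neg hz, if_neg hw, norm_mul,
    Real.log_mul (norm_ne_zero_iff.2 hz) (norm_ne_zero_iff.2 hw), neg_add]
  exact ENNReal.ofReal_add_le

theorem negLog_multiset_prod_le (s : Multiset ℂ) : negLog s.prod ≤ (s.map negLog).sum := by
  induction s using Multiset.induction_on with
  | empty => simp [negLog]
  | cons a s ih =>
    rw [Multiset.prod_cons, Multiset.map_cons, Multiset.sum_cons]
    exact (negLog_mul_le _ _).trans (by gcongr)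

theorem negLog_le_re (z : ℂ) : negLog z ≤ negLog z.re := by
  unfold negLog
  by_cases hr : z.re = 0
  · simp [hr]
  have hz : z ≠ 0 := fun h => hr (by simp [h])
  rw [if_neg hz, if_neg hr]
  refine ENNReal.ofReal_le_ofReal (neg_le_neg ?_)
  exact Real.log_le_log (norm_pos_iff.2 hr) (Complex.abs_re_le_norm z)

theorem measurable_negLog {E : Type*} [NormedAddCommGroup E] [MeasurableSpace E] [BorelSpace E] :
    Measurable (negLog : E → ENNReal) := by
  unfold negLog
  refine Measurable.ite (measurableSet_singleton 0) measurable_const ?_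
  exact (Real.measurable_log.comp measurable_norm).neg.ennreal_ofReal

theorem lintegral_negLog_real_ne_top : ∫⁻ x : ℝ, negLog x ≠ ⊤ := by
  have hint : IntegrableOn (fun x : ℝ => Real.log x) (Set.Ioc (-1) 1) :=
    (intervalIntegrable_iff_integrableOn_Ioc_of_le (by norm_num)).1
      intervalIntegral.intervalIntegrable_log'
  have hle : ∫⁻ x : ℝ, negLog x ≤ ∫⁻ x in Set.Ioc (-1 : ℝ) 1, ‖Real.log x‖ₑ := by
    rw [← lintegral_indicator measurableSet_Ioc]
    refine lintegral_mono_ae ?_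
    filter_upwards [Measure.ae_ne volume (0 : ℝ), Measure.ae_ne volume (-1 : ℝ)] with x hx hx1
    unfold negLog
    rw [if_neg hx, Real.norm_eq_abs, Real.log_abs]
    by_cases hmem : x ∈ Set.Ioc (-1 : ℝ) 1
    · rw [Set.indicator_of_mem hmem, Real.enorm_eq_ofReal_abs]
      exact ENNReal.ofReal_le_ofReal (neg_le_abs _)
    · rw [Set.indicator_of_notMem hmem, ENNReal.ofReal_of_nonpos]
      rw [neg_nonpos, ← Real.log_abs]
      refine Real.log_nonneg ?_
      by_contra! hlt
      rw [abs_lt] at hlt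
      exact hmem ⟨hlt.1, hlt.2.le⟩
  exact (hle.trans_lt hint.2).ne

/-- A law on `ℂ` has bounded logarithmic potential. -/
def HasBoundedLogPotential (ν : Measure ℂ) : Prop :=
  ∃ C : ENNReal, C ≠ ⊤ ∧ ∀ r : ℂ, ∫⁻ z, negLog (z - r) ∂ν ≤ C

theorem gaussianPDFReal_le (m : ℝ) (v : NNReal) (x : ℝ) :
    gaussianPDFReal m v x ≤ (√(2 * Real.pi * v))⁻¹ := by
  unfold gaussianPDFReal
  refine mul_le_of_le_one_right (by positivity) (Real.exp_le_one_iff.2 ?_)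
  have : 0 ≤ (x - m) ^ 2 / (2 * (v : ℝ)) := by positivity
  rw [neg_div]
  linarith

/-- Dropping the imaginary part only enlarges `negLog`. The real part has a bounded density, and
translation invariance of Lebesgue measure removes `r`. -/
theorem hasBoundedLogPotential_stdComplexGaussian :
    HasBoundedLogPotential ISAC.stdComplexGaussian := by
  classical
  refine ⟨ENNReal.ofReal (√(2 * Real.pi * ((1 / 2 : NNReal) : ℝ)))⁻¹ * ∫⁻ x : ℝ, negLog x,
    ENNReal.mul_ne_top ENNReal.ofReal_ne_top lintegral_negLog_real_ne_top, fun r => ?_⟩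
  have hmeas : Measurable (fun z : ℝ × ℝ => (⟨z.1, z.2⟩ : ℂ)) :=
    Complex.measurableEquivRealProd.symm.measurable
  have hmr : Measurable fun x : ℝ => negLog (x - r.re) := 
    measurable_negLog.comp (measurable_id.sub_const _)
  calc ∫⁻ z, negLog (z - r) ∂ISAC.stdComplexGaussian
      ≤ ∫⁻ z : ℂ, negLog (z.re - r.re) ∂ISAC.stdComplexGaussian :=
        lintegral_mono fun z => by simpa using negLog_le_re (z - r)
    _ = ∫⁻ x : ℝ, negLog (x - r.re) ∂(gaussianReal 0 (1 / 2)) := by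
        unfold ISAC.stdComplexGaussian
        rw [lintegral_map (f := fun z : ℂ => negLog (z.re - r.re)) (hmr.comp Complex.measurable_re) hmeas]
        rw [lintegral_prod _ (by exact (hmr.comp measurable_fst).aemeasurable)]
        simp
    _ = ∫⁻ x : ℝ, gaussianPDF 0 (1 / 2) x * negLog (x - r.re) := by
        rw [gaussianReal_of_var_ne_zero _ (by norm_num),
          lintegral_withDensity_eq_lintegral_mul _ (measurable_gaussianPDF _ _) hmr]
        rfl
    _ ≤ ∫⁻ x : ℝ, ENNReal.ofReal (√(2 * Real.pi * ((1 / 2 : NNReal) : ℝ)))⁻¹ *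
          negLog (x - r.re) := by
        refine lintegral_mono fun x => ?_
        gcongr
        exact ENNReal.ofReal_le_ofReal (gaussianPDFReal_le _ _ _)
    _ = _ := by
        rw [lintegral_const_mul _ hmr, lintegral_sub_right_eq_self (fun x : ℝ => negLog x)]

theorem lintegral_multiset_sum_le {α : Type*} [MeasurableSpace α] {ν : Measure α} {β : Type*}
    (s : Multiset β) (f : β → α → ENNReal) (hf : ∀ b, Measurable (f b)) {C : ENNReal}
    (hC : ∀ b, ∫⁻ x, f b x ∂ν ≤ C) :
    ∫⁻ x, (s.map fun b => f b x).sum ∂ν ≤ s.card * C := by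
  induction s using Multiset.induction_on with
  | empty => simp
  | cons a s ih =>
    simp only [Multiset.map_cons, Multiset.sum_cons, Multiset.card_cons, Nat.cast_add, Nat.cast_one]
    rw [lintegral_add_left (hf a), add_mul, one_mul, add_comm]
    exact add_le_add ih (hC a)

/-- Each linear factor over `ℂ` costs at most `C`, wherever its root lies. This uniformity is
essential when the coefficients, hence the roots, depend on further variables. -/
theorem lintegral_negLog_polynomial_le {ν : Measure ℂ} [IsProbabilityMeasure ν] {C : ENNReal}
    (hC : ∀ r : ℂ, ∫⁻ z, negLog (z - r) ∂ν ≤ C) (Q : Polynomial ℂ) :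
    ∫⁻ z, negLog (Q.eval z) ∂ν ≤ negLog Q.leadingCoeff + Q.natDegree * C := by
  have hroots := (IsAlgClosed.splits Q).eq_prod_roots
  have hev : ∀ z, Q.eval z = Q.leadingCoeff * (Q.roots.map fun r => z - r).prod := by
    intro z
    conv_lhs => rw [hroots]
    simp [Polynomial.eval_multiset_prod, Multiset.map_map]
  have hm : ∀ r : ℂ, Measurable fun z : ℂ => negLog (z - r) := fun r =>
    measurable_negLog.comp (measurable_id.sub_const _)
  calc ∫⁻ z, negLog (Q.eval z) ∂ν
      ≤ ∫⁻ z, (negLog Q.leadingCoeff + (Q.roots.map fun r => negLog (z - r)).sum) ∂ν := by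
        refine lintegral_mono fun z => ?_
        rw [hev z]
        refine (negLog_mul_le _ _).trans ?_
        gcongr
        refine (negLog_multiset_prod_le _).trans_eq ?_
        rw [Multiset.map_map]
        rfl
    _ = negLog Q.leadingCoeff + ∫⁻ z, (Q.roots.map fun r => negLog (z - r)).sum ∂ν := by
        rw [lintegral_add_left measurable_const]; simp
    _ ≤ negLog Q.leadingCoeff + Q.natDegree * C := by
        gcongr
        refine (lintegral_multiset_sum_le _ _ hm hC).trans ?_
        gcongr
        exact_mod_cast Polynomial.card_roots' Q

theorem MvPolynomial.measurable_eval {σ : Type*} (P : MvPolynomial σ ℂ) :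
    Measurable fun x : σ → ℂ => MvPolynomial.eval x P := by
  induction P using MvPolynomial.induction_on with
  | C a => simp
  | add p q hp hq => simp only [map_add]; exact hp.add hq
  | mul_X p i hp => simp only [map_mul, MvPolynomial.eval_X]; exact hp.mul (measurable_pi_apply i)

/-- Integrating out variable `0` leaves a constant plus `negLog` of the leading coefficient, which
is a nonzero polynomial in the remaining variables, so induction applies. -/
theorem lintegral_negLog_mvPolynomial_fin_ne_top {ν : Measure ℂ} [IsProbabilityMeasure ν]
    (hν : HasBoundedLogPotential ν) :
    ∀ (n : ℕ) (P : MvPolynomial (Fin n) ℂ), P ≠ 0 →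
      ∫⁻ x, negLog (MvPolynomial.eval x P) ∂(Measure.pi fun _ : Fin n => ν) ≠ ⊤ := by
  obtain ⟨C, hCtop, hC⟩ := hν
  intro n
  induction n with
  | zero =>
    intro P hP
    obtain ⟨a, rfl⟩ := MvPolynomial.C_surjective (Fin 0) P
    have ha : a ≠ 0 := by rintro rfl; simp at hP
    simp [negLog, ha]
  | succ n ih =>
    intro P hP
    set Q := MvPolynomial.finSuccEquiv ℂ n P with hQ
    have hQ0 : Q ≠ 0 := by simpa [hQ] using hP
    have hlc : Q.leadingCoeff ≠ 0 := Polynomial.leadingCoeff_ne_zero.2 hQ0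
    have hmp := (measurePreserving_piFinSuccAbove (fun _ : Fin (n + 1) => ν) 0).symm
    have hmeas : Measurable fun x : Fin (n + 1) → ℂ => negLog (MvPolynomial.eval x P) :=
      measurable_negLog.comp P.measurable_eval
    rw [← hmp.lintegral_comp hmeas, lintegral_prod_symm' _ (by exact hmeas.comp hmp.measurable)]
    refine ne_top_of_le_ne_top ?_ (lintegral_mono (g := fun y =>
      negLog (MvPolynomial.eval y Q.leadingCoeff) + Q.natDegree * C) fun y => ?_)
    · rw [lintegral_add_right _ measurable_const]
      refine ENNReal.add_ne_top.2 ⟨ih _ hlc, ?_⟩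
      simpa using ENNReal.mul_ne_top (ENNReal.natCast_ne_top _) hCtop
    -- Where the leading coefficient vanishes the bound is `⊤`; elsewhere specialization preserves
    -- both degree and leading coefficient.
    · by_cases hy : MvPolynomial.eval y Q.leadingCoeff = 0
      · simp [hy, negLog]
      · have hlead := Polynomial.leadingCoeff_map_of_leadingCoeff_ne_zero (MvPolynomial.eval y) hy
        have hdeg := Polynomial.natDegree_map_of_leadingCoeff_ne_zero (MvPolynomial.eval y) hy
        have := lintegral_negLog_polynomial_le hC (Q.map (MvPolynomial.eval y))
        rw [hlead, hdeg] at this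
        refine le_trans (le_of_eq ?_) this
        refine lintegral_congr fun x => ?_
        rw [← MvPolynomial.eval_eq_eval_mv_eval']
        simp [MeasurableEquiv.piFinSuccAbove, Fin.insertNthEquiv]

/-- The negative part of `log ‖P‖` is integrable for a nonzero polynomial `P` in independent
variables with a bounded logarithmic potential. -/
theorem lintegral_negLog_mvPolynomial_ne_top {σ : Type*} [Fintype σ] {ν : Measure ℂ}
    [IsProbabilityMeasure ν] (hν : HasBoundedLogPotential ν) {P : MvPolynomial σ ℂ} (hP : P ≠ 0) :
    ∫⁻ x, negLog (MvPolynomial.eval x P) ∂(Measure.pi fun _ : σ => ν) ≠ ⊤ := by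
  set e := Fintype.equivFin σ
  have hmp := measurePreserving_piCongrLeft (fun _ : σ => ν) e.symm
  have hmeas : Measurable fun x : σ → ℂ => negLog (MvPolynomial.eval x P) :=
    measurable_negLog.comp P.measurable_eval
  rw [← hmp.lintegral_comp hmeas]
  have hP' : MvPolynomial.rename e P ≠ 0 := by
    rwa [Ne, map_eq_zero_iff _ (MvPolynomial.rename_injective _ e.injective)]
  have := lintegral_negLog_mvPolynomial_fin_ne_top hν _ _ hP'
  convert this using 3 with x
  rw [MvPolynomial.eval_rename]
  congr 3
  funext i
  have := MeasurableEquiv.piCongrLeft_apply_apply (β := fun _ : σ => ℂ) e.symm x (e i)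
  simpa using this

/-! ### The sensing rate -/

namespace ISAC

theorem precoder_sensing_matrix {M : ℕ} {R U : Matrix (Fin M) (Fin M) ℂ} {lam : Fin M → ℝ}
    (hU : U ∈ Matrix.unitaryGroup (Fin M) ℂ)
    (hED : R = U * Matrix.diagonal (fun m => (lam m : ℂ)) * Uᴴ) {c : Fin M → ℝ}
    (hc : ∀ m, 0 ≤ c m) :
    (precoder U c)ᴴ * R * precoder U c = Matrix.diagonal fun m => ((lam m * c m : ℝ) : ℂ) := by
  have hUU : Uᴴ * U = 1 := Matrix.mem_unitaryGroup_iff'.1 hU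
  have h1 : (precoder U c)ᴴ * R * precoder U c =
      Matrix.diagonal (fun m => ((√(c m) : ℝ) : ℂ)) * (Uᴴ * U) *
        Matrix.diagonal (fun m => (lam m : ℂ)) * (Uᴴ * U) *
          Matrix.diagonal (fun m => ((√(c m) : ℝ) : ℂ)) := by
    unfold precoder
    rw [Matrix.conjTranspose_mul, Matrix.diagonal_conjTranspose, hED]
    have : star (fun m => ((√(c m) : ℝ) : ℂ)) = fun m => ((√(c m) : ℝ) : ℂ) := by
      funext m; simp
    rw [this]
    simp only [Matrix.mul_assoc]
  rw [h1, hUU, Matrix.mul_one, Matrix.mul_one, Matrix.diagonal_mul_diagonal,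
    Matrix.diagonal_mul_diagonal]
  congr 1
  funext m
  rw [← Complex.ofReal_mul, ← Complex.ofReal_mul, mul_right_comm, Real.mul_self_sqrt (hc m),
    mul_comm]

theorem sensingRate_precoder {M : ℕ} (N L : ℕ) {R U : Matrix (Fin M) (Fin M) ℂ} {lam : Fin M → ℝ}
    (hU : U ∈ Matrix.unitaryGroup (Fin M) ℂ)
    (hED : R = U * Matrix.diagonal (fun m => (lam m : ℂ)) * Uᴴ) (hlam : ∀ m, 0 < lam m)
    {c : Fin M → ℝ} (hc : ∀ m, 0 ≤ c m) :
    sensingRate N L R (precoder U c) =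
      (N : ℝ) / L * ∑ m, Real.logb 2 (1 + (L : ℝ) * lam m * c m) := by
  unfold sensingRate
  rw [precoder_sensing_matrix hU hED hc]
  have h1 : (1 + (L : ℂ) • Matrix.diagonal fun m => ((lam m * c m : ℝ) : ℂ)) =
      Matrix.diagonal fun m => ((1 + (L : ℝ) * lam m * c m : ℝ) : ℂ) := by
    rw [← Matrix.diagonal_one, ← Matrix.diagonal_smul, Matrix.diagonal_add]
    congr 1
    funext m
    simp [mul_assoc]
  rw [h1, Matrix.det_diagonal, ← Complex.ofReal_prod, Complex.ofReal_re, Real.logb_prod]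
  intro m _
  have := mul_nonneg (mul_nonneg (Nat.cast_nonneg (α := ℝ) L) (hlam m).le) (hc m)
  linarith

theorem eigenvalue_pos {M : ℕ} {R U : Matrix (Fin M) (Fin M) ℂ} {lam : Fin M → ℝ}
    (hR : R.PosDef) (hU : U ∈ Matrix.unitaryGroup (Fin M) ℂ)
    (hED : R = U * Matrix.diagonal (fun m => (lam m : ℂ)) * Uᴴ) (m : Fin M) : 0 < lam m := by
  have hUU : Uᴴ * U = 1 := Matrix.mem_unitaryGroup_iff'.1 hU
  have hinj : Function.Injective U.mulVec := fun x y hxy => by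
    have := congrArg (Uᴴ *ᵥ ·) hxy
    simpa [Matrix.mulVec_mulVec, hUU] using this
  have h := hR.conjTranspose_mul_mul_same hinj
  have h1 : Uᴴ * R * U = Matrix.diagonal (fun m => (lam m : ℂ)) := by
    rw [hED]
    calc Uᴴ * (U * Matrix.diagonal (fun m => (lam m : ℂ)) * Uᴴ) * U
        = (Uᴴ * U) * Matrix.diagonal (fun m => (lam m : ℂ)) * (Uᴴ * U) := by
          simp only [Matrix.mul_assoc]
      _ = _ := by rw [hUU, Matrix.one_mul, Matrix.mul_one]
  rw [h1, Matrix.posDef_diagonal_iff] at h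
  exact_mod_cast h m

theorem trace_precoder {M : ℕ} {U : Matrix (Fin M) (Fin M) ℂ}
    (hU : U ∈ Matrix.unitaryGroup (Fin M) ℂ) {c : Fin M → ℝ} (hc : ∀ m, 0 ≤ c m) :
    (precoder U c * (precoder U c)ᴴ).trace.re = ∑ m, c m := by
  have h := precoder_sensing_matrix (R := 1) (lam := fun _ => 1) hU (by
    simp only [Complex.ofReal_one, Matrix.diagonal_one, Matrix.mul_one]
    exact (Matrix.mem_unitaryGroup_iff.1 hU).symm) hc
  rw [Matrix.mul_one] at h
  rw [Matrix.trace_mul_comm, h, Matrix.trace_diagonal, ← Complex.ofReal_sum, Complex.ofReal_re]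
  simp

theorem posDef_one_add_sensing {M : ℕ} (L : ℕ) {R : Matrix (Fin M) (Fin M) ℂ} (hR : R.PosDef)
    (W : Matrix (Fin M) (Fin M) ℂ) : (1 + (L : ℂ) • (Wᴴ * R * W)).PosDef :=
  Matrix.PosDef.one.add_posSemidef
    ((hR.posSemidef.conjTranspose_mul_mul_same W).smul (by positivity))

theorem det_re_pos {M : ℕ} {B : Matrix (Fin M) (Fin M) ℂ} (hB : B.PosDef) : 0 < B.det.re :=
  (Complex.pos_iff.1 hB.det_pos).1

theorem continuous_sensingRate {M : ℕ} (N L : ℕ) {R : Matrix (Fin M) (Fin M) ℂ} (hR : R.PosDef) :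
    Continuous (sensingRate N L R) := by
  unfold sensingRate
  have hc : Continuous fun W : Matrix (Fin M) (Fin M) ℂ =>
      (1 + (L : ℂ) • (Wᴴ * R * W)).det.re := by
    refine Complex.continuous_re.comp (Continuous.matrix_det ?_)
    fun_prop
  refine continuous_const.mul ?_
  unfold Real.logb
  exact (hc.log fun W => (det_re_pos (posDef_one_add_sensing L hR W)).ne').div_const _

theorem trace_mul_conjTranspose_re {M : ℕ} (W : Matrix (Fin M) (Fin M) ℂ) :
    (W * Wᴴ).trace.re = ∑ i, ∑ j, ‖W i j‖ ^ 2 := by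
  rw [Matrix.trace, Complex.re_sum]
  refine Finset.sum_congr rfl fun i _ => ?_
  rw [Matrix.diag_apply, Matrix.mul_apply, Complex.re_sum]
  refine Finset.sum_congr rfl fun j _ => ?_
  rw [Matrix.conjTranspose_apply, ← Complex.normSq_eq_norm_sq, Complex.star_def, Complex.mul_conj,
    Complex.ofReal_re]

theorem isCompact_powerBudget (M : ℕ) (p : ℝ) :
    IsCompact {W : Matrix (Fin M) (Fin M) ℂ | (W * Wᴴ).trace.re ≤ p} := by
  have hsub : {W : Matrix (Fin M) (Fin M) ℂ | (W * Wᴴ).trace.re ≤ p} ⊆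
      Set.pi Set.univ fun _ : Fin M => Set.pi Set.univ fun _ : Fin M =>
        Metric.closedBall (0 : ℂ) √p := by
    intro W hW
    suffices h : ∀ i j, ‖W i j‖ ≤ √p from fun i _ j _ => mem_closedBall_zero_iff.2 (h i j)
    intro i j
    rw [Set.mem_ofPred_eq, trace_mul_conjTranspose_re] at hW
    refine Real.le_sqrt_of_sq_le (le_trans ?_ hW)
    exact (Finset.single_le_sum (f := fun j => ‖W i j‖ ^ 2) (fun _ _ => by positivity)
      (Finset.mem_univ j)).trans (Finset.single_le_sum (f := fun i => ∑ j, ‖W i j‖ ^ 2)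
      (fun _ _ => by positivity) (Finset.mem_univ i))
  refine IsCompact.of_isClosed_subset (isCompact_univ_pi fun _ => isCompact_univ_pi fun _ =>
    isCompact_closedBall _ _) ?_ hsub
  refine isClosed_le (Complex.continuous_re.comp ?_) continuous_const
  exact Continuous.matrix_trace (by fun_prop)

theorem isGreatest_maxSensingRate {M : ℕ} (N L : ℕ) {R : Matrix (Fin M) (Fin M) ℂ}
    (hR : R.PosDef) {p : ℝ} (hp : 0 ≤ p) :
    IsGreatest (achievableSensingRates N L R p) (maxSensingRate N L R p) := by
  refine ((isCompact_powerBudget M p).image (continuous_sensingRate N L hR)).isGreatest_sSup ?_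
  exact Set.Nonempty.image _ ⟨0, by simpa using hp⟩

/-- The inequality of arithmetic and geometric means for the eigenvalues of a matrix. -/
theorem det_re_le_trace_pow {M : ℕ} (hM : 0 < M) {B : Matrix (Fin M) (Fin M) ℂ} (hB : B.PosDef) :
    B.det.re ≤ (B.trace.re / M) ^ M := by
  have hMR : (0 : ℝ) < M := by exact_mod_cast hM
  have hpos := hB.eigenvalues_pos
  rw [hB.1.det_eq_prod_eigenvalues, hB.1.trace_eq_sum_eigenvalues]
  simp only [Complex.coe_algebraMap]
  rw [← Complex.ofReal_prod, ← Complex.ofReal_sum, Complex.ofReal_re, Complex.ofReal_re]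
  have h := Real.geom_mean_le_arith_mean Finset.univ (fun _ : Fin M => (1 : ℝ)) hB.1.eigenvalues
    (fun _ _ => zero_le_one) (by simpa using hMR) (fun i _ => (hpos i).le)
  simp only [Real.rpow_one, one_mul, Finset.sum_const, Finset.card_univ, Fintype.card_fin,
    nsmul_eq_mul, mul_one] at h
  have h0 : 0 ≤ ∏ i, hB.1.eigenvalues i := Finset.prod_nonneg fun i _ => (hpos i).le
  calc ∏ i, hB.1.eigenvalues i = ((∏ i, hB.1.eigenvalues i) ^ ((M : ℝ)⁻¹)) ^ M := by
        rw [← Real.rpow_natCast, ← Real.rpow_mul h0, inv_mul_cancel₀ hMR.ne', Real.rpow_one]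
    _ ≤ _ := by gcongr

theorem det_eq_prod_eigenvalue {M : ℕ} {R U : Matrix (Fin M) (Fin M) ℂ} {lam : Fin M → ℝ}
    (hU : U ∈ Matrix.unitaryGroup (Fin M) ℂ)
    (hED : R = U * Matrix.diagonal (fun m => (lam m : ℂ)) * Uᴴ) :
    R.det = ((∏ m, lam m : ℝ) : ℂ) := by
  rw [hED, Matrix.det_mul_right_comm, show U * Uᴴ = 1 from Matrix.mem_unitaryGroup_iff.1 hU,
    Matrix.one_mul, Matrix.det_diagonal, Complex.ofReal_prod]

/-- By Sylvester's identity the determinant is `det R · det (R⁻¹ + L W Wᴴ)`. The second factor is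
bounded by AM-GM through its trace, which the power budget controls. -/
theorem sensingRate_le {M : ℕ} (hM : 0 < M) (N : ℕ) {L : ℕ} (hL : 0 < L)
    {R U : Matrix (Fin M) (Fin M) ℂ}
    {lam : Fin M → ℝ} (hR : R.PosDef) (hU : U ∈ Matrix.unitaryGroup (Fin M) ℂ)
    (hED : R = U * Matrix.diagonal (fun m => (lam m : ℂ)) * Uᴴ)
    {p : ℝ} (hp : 0 < p) {W : Matrix (Fin M) (Fin M) ℂ} (hW : (W * Wᴴ).trace.re ≤ p) :
    sensingRate N L R W ≤ (N : ℝ) / L *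
      (∑ m, Real.logb 2 (lam m) + M * Real.logb 2 (((R⁻¹).trace.re + L * p) / M)) := by
  have hMR : (0 : ℝ) < M := by exact_mod_cast hM
  have hLR : (0 : ℝ) < L := by exact_mod_cast hL
  have hlam := eigenvalue_pos hR hU hED
  have hdetR := det_eq_prod_eigenvalue hU hED
  have hRu : IsUnit R.det := hR.det_pos.ne'.isUnit
  set B := R⁻¹ + (L : ℂ) • (W * Wᴴ) with hB
  have hBpos : B.PosDef := hR.inv.add_posSemidef
    ((Matrix.posSemidef_self_mul_conjTranspose W).smul (by positivity))
  have hdet : (1 + (L : ℂ) • (Wᴴ * R * W)).det = R.det * B.det := by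
    rw [← Matrix.det_mul, hB, Matrix.mul_add, Matrix.mul_nonsing_inv _ hRu]
    have := Matrix.det_one_add_mul_comm Wᴴ ((L : ℂ) • (R * W))
    rw [Matrix.mul_smul, ← Matrix.mul_assoc, Matrix.smul_mul] at this
    rw [this, Matrix.mul_smul, Matrix.mul_assoc]
  have htrinv : 0 ≤ (R⁻¹).trace.re := (Complex.nonneg_iff.1 hR.inv.posSemidef.trace_nonneg).1
  have htr : B.trace.re ≤ (R⁻¹).trace.re + L * p := by
    have hlp := mul_le_mul_of_nonneg_left hW hLR.le
    rw [hB, Matrix.trace_add, Matrix.trace_smul, Complex.add_re, smul_eq_mul]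
    simpa using hlp
  have htr0 : 0 ≤ B.trace.re := (Complex.nonneg_iff.1 hBpos.posSemidef.trace_nonneg).1
  have hprod : 0 < ∏ m, lam m := Finset.prod_pos fun m _ => hlam m
  have hq : 0 < ((R⁻¹).trace.re + L * p) / M := by positivity
  have hle : (1 + (L : ℂ) • (Wᴴ * R * W)).det.re ≤
      (∏ m, lam m) * (((R⁻¹).trace.re + L * p) / M) ^ M := by
    rw [hdet, hdetR, Complex.re_ofReal_mul]
    gcongr
    exact (det_re_le_trace_pow hM hBpos).trans (by gcongr)
  unfold sensingRate
  gcongr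
  refine (Real.logb_le_logb_of_le one_lt_two
    (det_re_pos (posDef_one_add_sensing L hR W)) hle).trans_eq ?_
  rw [Real.logb_mul hprod.ne' (by positivity), Real.logb_prod _ _ fun m _ => (hlam m).ne',
    Real.logb_pow]

theorem highSNRSensingRate_eq {M : ℕ} (hM : 0 < M) (N L : ℕ) (lam : Fin M → ℝ) (p : ℝ) :
    highSNRSensingRate N L lam p =
      (N : ℝ) / L * ∑ m, (Real.logb 2 p + Real.logb 2 ((L : ℝ) * lam m / M)) := by
  have hMR : (M : ℝ) ≠ 0 := by exact_mod_cast hM.ne'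
  unfold highSNRSensingRate
  rw [Finset.sum_add_distrib, Finset.sum_const, Finset.card_univ, Fintype.card_fin, nsmul_eq_mul]
  field_simp

/-- Allocate `p / M` to every eigendirection and drop the `1` inside each logarithm. -/
theorem highSNRSensingRate_le_maxSensingRate {M : ℕ} (hM : 0 < M) (N : ℕ) {L : ℕ} (hL : 0 < L)
    {R U : Matrix (Fin M) (Fin M) ℂ}
    {lam : Fin M → ℝ} (hR : R.PosDef) (hU : U ∈ Matrix.unitaryGroup (Fin M) ℂ)
    (hED : R = U * Matrix.diagonal (fun m => (lam m : ℂ)) * Uᴴ) {p : ℝ} (hp : 0 < p) :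
    highSNRSensingRate N L lam p ≤ maxSensingRate N L R p := by
  have hMR : (0 : ℝ) < M := by exact_mod_cast hM
  have hLR : (0 : ℝ) < L := by exact_mod_cast hL
  have hlam := eigenvalue_pos hR hU hED
  have hc : ∀ m : Fin M, 0 ≤ (fun _ : Fin M => p / M) m := fun _ => by positivity
  have hmem : sensingRate N L R (precoder U fun _ => p / M) ∈ achievableSensingRates N L R p := by
    refine ⟨_, ?_, rfl⟩
    rw [Set.mem_ofPred_eq, trace_precoder hU hc, Finset.sum_const, Finset.card_univ,
      Fintype.card_fin, nsmul_eq_mul, mul_div_cancel₀ _ hMR.ne']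
  refine le_trans ?_ ((isGreatest_maxSensingRate N L hR hp.le).2 hmem)
  rw [sensingRate_precoder N L hU hED hlam hc, highSNRSensingRate_eq hM]
  gcongr with m
  have := hlam m
  rw [← Real.logb_mul hp.ne' (by positivity)]
  refine Real.logb_le_logb_of_le one_lt_two (by positivity) ?_
  have : p * (L * lam m / M) = L * lam m * (p / M) := by ring
  linarith

/-- The difference lies between `0` and `(N M / L) log₂ (1 + tr R⁻¹ / (L p))`. -/
theorem tendsto_maxSensingRate_sub {M : ℕ} (hM : 0 < M) (N : ℕ) {L : ℕ} (hL : 0 < L)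
    {R U : Matrix (Fin M) (Fin M) ℂ}
    {lam : Fin M → ℝ} (hR : R.PosDef) (hU : U ∈ Matrix.unitaryGroup (Fin M) ℂ)
    (hED : R = U * Matrix.diagonal (fun m => (lam m : ℂ)) * Uᴴ) :
    Tendsto (fun p : ℝ => maxSensingRate N L R p - highSNRSensingRate N L lam p) atTop (𝓝 0) := by
  have hMR : (0 : ℝ) < M := by exact_mod_cast hM
  have hLR : (0 : ℝ) < L := by exact_mod_cast hL
  have hlam := eigenvalue_pos hR hU hED
  set t := (R⁻¹).trace.re with ht
  have ht0 : 0 ≤ t := (Complex.nonneg_iff.1 hR.inv.posSemidef.trace_nonneg).1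
  have hlim : Tendsto (fun p : ℝ => (N : ℝ) / L * (M * Real.logb 2 (1 + t / L / p))) atTop (𝓝 0) := by
    have h1 : Tendsto (fun p : ℝ => 1 + t / L / p) atTop (𝓝 1) := by
      simpa using (tendsto_const_nhds (x := t / L)).div_atTop tendsto_id |>.const_add 1
    have h2 : Tendsto (fun p : ℝ => Real.logb 2 (1 + t / L / p)) atTop (𝓝 0) := by
      unfold Real.logb
      simpa using (h1.log one_ne_zero).div_const (Real.log 2)
    simpa using (h2.const_mul (M : ℝ)).const_mul ((N : ℝ) / L)
  refine tendsto_of_tendsto_of_tendsto_of_le_of_le' tendsto_const_nhds hlim ?_ ?_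
  · filter_upwards [eventually_gt_atTop 0] with p hp
    exact sub_nonneg.2 (highSNRSensingRate_le_maxSensingRate hM N hL hR hU hED hp)
  · filter_upwards [eventually_gt_atTop 0] with p hp
    obtain ⟨W, hW, hWeq⟩ := (isGreatest_maxSensingRate N L hR hp.le).1
    rw [← hWeq, highSNRSensingRate_eq hM, sub_le_iff_le_add, ← mul_add]
    refine (sensingRate_le hM N hL hR hU hED hp hW).trans ?_
    refine mul_le_mul_of_nonneg_left ?_ (by positivity)
    have hsplit : Real.logb 2 ((t + L * p) / M) =
        Real.logb 2 (1 + t / L / p) + Real.logb 2 p + Real.logb 2 (L / M) := by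
      rw [← Real.logb_mul (by positivity) (by positivity),
        ← Real.logb_mul (by positivity) (by positivity)]
      congr 1
      field_simp
      ring
    have hm : ∀ m, Real.logb 2 (L * lam m / M) = Real.logb 2 (lam m) + Real.logb 2 (L / M) := by
      intro m
      have := hlam m
      rw [← Real.logb_mul (by positivity) (by positivity)]
      congr 1
      ring
    rw [← ht, hsplit, Finset.sum_add_distrib, Finset.sum_congr rfl fun m _ => hm m,
      Finset.sum_add_distrib, Finset.sum_const, Finset.sum_const, Finset.card_univ,
      Fintype.card_fin, nsmul_eq_mul, nsmul_eq_mul]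
    exact le_of_eq (by ring)

end ISAC

/-! ### Random channels -/

section MatrixMeasurability

variable {Ω : Type*} [MeasurableSpace Ω] {μ : Measure Ω} {l m n : Type*}

theorem aemeasurable_matrix_mul_apply [Fintype m] {A : Ω → Matrix l m ℂ} {B : Ω → Matrix m n ℂ}
    (hA : ∀ i j, AEMeasurable (fun ω => A ω i j) μ) (hB : ∀ i j, AEMeasurable (fun ω => B ω i j) μ)
    (i : l) (j : n) : AEMeasurable (fun ω => (A ω * B ω) i j) μ := by
  simp only [Matrix.mul_apply]
  exact Finset.aemeasurable_fun_sum _ fun k _ => (hA i k).mul (hB k j)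

theorem aemeasurable_matrix_det [Fintype n] [DecidableEq n] {A : Ω → Matrix n n ℂ}
    (hA : ∀ i j, AEMeasurable (fun ω => A ω i j) μ) : AEMeasurable (fun ω => (A ω).det) μ := by
  simp only [Matrix.det_apply]
  exact Finset.aemeasurable_fun_sum _ fun σ _ =>
    (Finset.aemeasurable_fun_prod _ fun i _ => hA (σ i) i).const_smul _

theorem aemeasurable_matrix_inv_apply [Fintype n] [DecidableEq n] {A : Ω → Matrix n n ℂ}
    (hA : ∀ i j, AEMeasurable (fun ω => A ω i j) μ) (i j : n) :
    AEMeasurable (fun ω => (A ω)⁻¹ i j) μ := by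
  simp only [Matrix.inv_def, Matrix.smul_apply, Matrix.adjugate_apply, Ring.inverse_eq_inv',
    smul_eq_mul]
  refine (aemeasurable_matrix_det hA).inv.mul (aemeasurable_matrix_det fun k l => ?_)
  simp only [Matrix.updateRow_apply]
  split_ifs
  · exact aemeasurable_const
  · exact hA k l

end MatrixMeasurability

namespace ISAC

instance isProbabilityMeasure_stdComplexGaussian : IsProbabilityMeasure stdComplexGaussian :=
  Measure.isProbabilityMeasure_map
    Complex.measurableEquivRealProd.symm.measurable.aemeasurable

theorem integrable_norm_stdComplexGaussian : Integrable (fun z : ℂ => ‖z‖) stdComplexGaussian := by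
  have hg : Integrable (fun x : ℝ => |x|) (gaussianReal 0 (1 / 2)) :=
    ((memLp_id_gaussianReal (μ := 0) (v := 1 / 2) 1).integrable (by simp)).abs
  have hmeas : Measurable (fun z : ℝ × ℝ => (⟨z.1, z.2⟩ : ℂ)) :=
    Complex.measurableEquivRealProd.symm.measurable
  unfold stdComplexGaussian
  rw [integrable_map_measure continuous_norm.aestronglyMeasurable hmeas.aemeasurable]
  refine ((hg.comp_fst (gaussianReal 0 (1 / 2))).add (hg.comp_snd (gaussianReal 0 (1 / 2)))).mono'
    (continuous_norm.measurable.comp hmeas).aestronglyMeasurable (ae_of_all _ fun z => ?_)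
  simpa using Complex.norm_le_abs_re_add_abs_im ⟨z.1, z.2⟩

section Channel

variable {Ω : Type*} [MeasurableSpace Ω] {μ : Measure Ω} {M K : ℕ}

theorem aemeasurable_zfVector {A : Ω → Matrix (Fin K) (Fin M) ℂ}
    (hA : ∀ i j, AEMeasurable (fun ω => A ω i j) μ) (m : Fin M) (k : Fin K) :
    AEMeasurable (fun ω => zfVector (A ω) m k) μ := by
  have hA' : ∀ i j, AEMeasurable (fun ω => (A ω)ᴴ i j) μ := fun i j => 
    continuous_star.measurable.comp_aemeasurable (hA j i)
  exact aemeasurable_matrix_mul_apply hA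
    (aemeasurable_matrix_inv_apply (aemeasurable_matrix_mul_apply hA' hA)) k m

theorem aemeasurable_channelGain {A : Ω → Matrix (Fin K) (Fin M) ℂ}
    (hA : ∀ i j, AEMeasurable (fun ω => A ω i j) μ) (m : Fin M) :
    AEMeasurable (fun ω => channelGain (A ω) m) μ := by
  have hq := aemeasurable_zfVector hA m
  unfold channelGain equalizer
  simp only [dotProduct, Pi.star_apply, Pi.smul_apply, EuclideanSpace.norm_eq, smul_eq_mul]
  refine (AEMeasurable.norm ?_).pow_const 2
  refine Finset.aemeasurable_fun_sum _ fun k _ => 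
    (continuous_star.measurable.comp_aemeasurable ?_).mul (hA k m)
  refine AEMeasurable.mul ?_ (hq k)
  refine Complex.measurable_ofReal.comp_aemeasurable (AEMeasurable.inv ?_)
  exact (Finset.aemeasurable_fun_sum _ fun i _ => (hq i).norm.pow_const 2).sqrt

variable {H : Fin M → Ω → Matrix (Fin K) (Fin M) ℂ}

theorem IsRayleigh.aemeasurable (hH : IsRayleigh H μ) (m : Fin M) (i : Fin K) (j : Fin M) :
    AEMeasurable (fun ω => H m ω i j) μ :=
  (hH.law m i j).aemeasurable

theorem IsRayleigh.aemeasurable_gains (hH : IsRayleigh H μ) (U : Matrix (Fin M) (Fin M) ℂ)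
    (m : Fin M) : AEMeasurable (fun ω => gains (fun m => H m ω) U m) μ := by
  have hA : ∀ i j, AEMeasurable (fun ω => (H m ω * U) i j) μ :=
    aemeasurable_matrix_mul_apply (B := fun _ => U) (hH.aemeasurable m) fun _ _ =>
      aemeasurable_const
  exact aemeasurable_channelGain hA m

theorem IsRayleigh.integrable_norm (hH : IsRayleigh H μ) (m : Fin M) (i : Fin K) (j : Fin M) :
    Integrable (fun ω => ‖H m ω i j‖) μ := by
  have h := integrable_norm_stdComplexGaussian
  rw [← (hH.law m i j).map_eq, integrable_map_measure continuous_norm.aestronglyMeasurable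
    (hH.aemeasurable m i j)] at h
  exact h

/-- The generic determinant is a nonzero polynomial, evaluated here at `M²` of the i.i.d. entries.
-/
theorem IsRayleigh.lintegral_negLog_det_ne_top [IsProbabilityMeasure μ] (hH : IsRayleigh H μ)
    (hK : M ≤ K) (m : Fin M) : ∫⁻ ω, negLog (topBlock hK (H m ω)).det ∂μ ≠ ⊤ := by
  set f : Fin M × Fin M → Ω → ℂ := fun x ω => H m ω (Fin.castLE hK x.1) x.2 with hf
  have hfm : ∀ x, AEMeasurable (f x) μ := fun x => hH.aemeasurable _ _ _
  have hind : iIndepFun f μ :=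
    hH.indep.precomp (g := fun x : Fin M × Fin M => (m, Fin.castLE hK x.1, x.2))
      (fun x y hxy => by
        simp only [Prod.mk.injEq, true_and] at hxy
        exact Prod.ext (Fin.castLE_injective hK hxy.1) hxy.2)
  have hlaw : μ.map (fun ω x => f x ω) = Measure.pi fun _ => stdComplexGaussian := by
    rw [(iIndepFun_iff_map_fun_eq_pi_map hfm).1 hind]
    congr 1
    funext x
    exact (hH.law _ _ _).map_eq
  have hP := lintegral_negLog_mvPolynomial_ne_top hasBoundedLogPotential_stdComplexGaussian
    (Matrix.det_mvPolynomialX_ne_zero (Fin M) ℂ)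
  rw [← hlaw, lintegral_map' (by
    exact (measurable_negLog.comp (MvPolynomial.measurable_eval _)).aemeasurable)
    (aemeasurable_pi_lambda _ hfm)] at hP
  convert hP using 4 with ω
  rw [RingHom.map_det]
  congr 1
  exact (Matrix.mvPolynomialX_mapMatrix_eval (topBlock hK (H m ω))).symm

theorem norm_det_topBlock_mul (hK : M ≤ K) (A : Matrix (Fin K) (Fin M) ℂ)
    {U : Matrix (Fin M) (Fin M) ℂ} (hU : U ∈ Matrix.unitaryGroup (Fin M) ℂ) :
    ‖(topBlock hK (A * U)).det‖ = ‖(topBlock hK A).det‖ := by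
  have hdet : U.det ∈ unitary ℂ := Matrix.det_of_mem_unitary hU
  rw [topBlock_mul, Matrix.det_mul, norm_mul, CStarRing.norm_of_mem_unitary hdet, mul_one]

/-- The logarithm of the reciprocal channel gain is dominated by an integrable variable. -/
theorem IsRayleigh.exists_integrable_bound [IsProbabilityMeasure μ] (hH : IsRayleigh H μ)
    (hK : M ≤ K) {U : Matrix (Fin M) (Fin M) ℂ} (hU : U ∈ Matrix.unitaryGroup (Fin M) ℂ)
    (m : Fin M) :
    ∃ b : Ω → ℝ, Integrable b μ ∧ ∀ᵐ ω ∂μ, 0 < gains (fun m => H m ω) U m ∧ 0 ≤ b ω ∧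
      Real.log (1 / gains (fun m => H m ω) U m) ≤ b ω := by
  have hM : (1 : ℝ) ≤ M := by exact_mod_cast m.pos
  have hneg := hH.lintegral_negLog_det_ne_top hK m
  have hmeas : AEMeasurable (fun ω => negLog (topBlock hK (H m ω)).det) μ :=
    measurable_negLog.comp_aemeasurable
      (aemeasurable_matrix_det fun i j => hH.aemeasurable m (Fin.castLE hK i) j)
  set Y : Ω → ℝ := fun ω => ∑ i, ∑ j, ‖H m ω i j‖ with hY
  have hYint : Integrable Y μ := integrable_finsetSum _ fun i _ =>
    integrable_finsetSum _ fun j _ => hH.integrable_norm m i j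
  have hY0 : ∀ ω, 0 ≤ Y ω := fun ω => by positivity
  -- The logarithm of `M (M! X ^ M / |det|)²` with `X = 1 + Y`, after `log (1 + Y) ≤ Y`.
  refine ⟨fun ω => Real.log M + 2 * Real.log M.factorial + 2 * M * Y ω +
    2 * (negLog (topBlock hK (H m ω)).det).toReal, ?_, ?_⟩
  · exact ((integrable_const _).add (hYint.const_mul _)).add
      ((integrable_toReal_of_lintegral_ne_top hmeas hneg).const_mul _)
  · filter_upwards [ae_lt_top' hmeas hneg] with ω hω
    have hdet : (topBlock hK (H m ω)).det ≠ 0 := by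
      intro h0
      simp [negLog, h0] at hω
    have hdetU : (topBlock hK (H m ω * U)).det ≠ 0 := by
      rwa [← norm_ne_zero_iff, norm_det_topBlock_mul hK _ hU, norm_ne_zero_iff]
    have hpos : 0 < channelGain (H m ω * U) m :=
      channelGain_pos (isUnit_det_of_topBlock hK hdetU) m
    have hd : 0 < ‖(topBlock hK (H m ω)).det‖ := norm_pos_iff.2 hdet
    have hfac : (1 : ℝ) ≤ M.factorial := by exact_mod_cast M.factorial_pos
    have hlM := Real.log_nonneg hM
    have hlf := Real.log_nonneg hfac
    refine ⟨hpos, by have := hY0 ω; positivity, ?_⟩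
    have hX : 1 ≤ 1 + Y ω := by linarith [hY0 ω]
    have hent : ∀ i j, ‖(H m ω * U) i j‖ ≤ 1 + Y ω := fun i j => by
      refine (norm_mul_unitary_apply_le _ hU i j).trans ?_
      have := Finset.single_le_sum (f := fun i => ∑ k, ‖H m ω i k‖)
        (fun _ _ => by positivity) (Finset.mem_univ i)
      exact this.trans (by simp [hY])
    have hle := one_div_channelGain_le hK hdetU hX hent m
    rw [norm_det_topBlock_mul hK _ hU] at hle
    have hlog := Real.log_le_log (one_div_pos.2 hpos) hle
    refine hlog.trans ?_
    have hXp : 0 < 1 + Y ω := by linarith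
    rw [Real.log_mul (by positivity) (by positivity), Real.log_pow, Real.log_div (by positivity)
      hd.ne', Real.log_mul (by positivity) (by positivity), Real.log_pow]
    have h1 : Real.log (1 + Y ω) ≤ Y ω := by linarith [Real.log_le_sub_one_of_pos hXp]
    have h2 : -Real.log ‖(topBlock hK (H m ω)).det‖ ≤
        (negLog (topBlock hK (H m ω)).det).toReal := by
      unfold negLog
      rw [if_neg hdet, ENNReal.toReal_ofReal']
      exact le_max_left _ _
    have h3 : (M : ℝ) * Real.log (1 + Y ω) ≤ M * Y ω := by gcongr
    push_cast
    linarith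

end Channel

end ISAC

/-! ### High-SNR behaviour of the water-filling allocation -/

section HighSNR

/-- A logarithmic rate deviates from its high-SNR expression by a controlled amount. -/
theorem abs_logb_one_add_sub_le {κ n p x a b : ℝ} (hκ : 0 < κ) (hn : 0 < n) (hp : 1 ≤ p)
    (hx0 : 0 ≤ x) (hxp : x ≤ p) (hxa : p / n - a ≤ x) (ha : 0 < a) (hb : 0 ≤ b)
    (hab : Real.log a ≤ b) :
    |Real.logb 2 (1 + κ * x) - (Real.logb 2 p + Real.logb 2 (κ / n))| ≤
      1 + |Real.logb 2 (1 + κ)| + |Real.logb 2 (κ / n)| + |Real.logb 2 κ| + b / Real.log 2 := by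
  have hp0 : 0 < p := by linarith
  have hl2 : 0 < Real.log 2 := Real.log_pos one_lt_two
  have hbl : 0 ≤ b / Real.log 2 := by positivity
  have hal : Real.logb 2 a ≤ b / Real.log 2 := by unfold Real.logb; gcongr
  have hκx : 0 ≤ κ * x := by positivity
  have hup : Real.logb 2 (1 + κ * x) ≤ Real.logb 2 p + Real.logb 2 (1 + κ) := by
    rw [← Real.logb_mul hp0.ne' (by positivity)]
    refine Real.logb_le_logb_of_le one_lt_two (by positivity) ?_
    have := mul_le_mul_of_nonneg_left hxp hκ.le
    nlinarith
  have h1 := le_abs_self (Real.logb 2 (1 + κ))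
  have h2' := neg_abs_le (Real.logb 2 (κ / n))
  have h3 := le_abs_self (Real.logb 2 κ)
  have h22 : Real.logb 2 2 = 1 := Real.logb_self_eq_one one_lt_two
  refine abs_le.2 ⟨?_, by linarith [abs_nonneg (Real.logb 2 κ)]⟩
  rw [← Real.logb_mul hp0.ne' (by positivity)]
  -- In the first case `x ≥ p / (2n)`, which costs at most one bit. In the second `p < 2 n a`, so
  -- the high-SNR expression is at most `1 + log₂ κ + log₂ a` while the rate is nonnegative.
  rcases le_or_gt a (p / n / 2) with hsmall | hlarge
  · have hlow : Real.logb 2 (p * (κ / n)) - 1 ≤ Real.logb 2 (1 + κ * x) := by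
      rw [← h22, ← Real.logb_div (by positivity) two_ne_zero]
      refine Real.logb_le_logb_of_le one_lt_two (by positivity) ?_
      have : κ * (p / n / 2) ≤ κ * x := mul_le_mul_of_nonneg_left (by linarith) hκ.le
      have e : p * (κ / n) / 2 = κ * (p / n / 2) := by ring
      linarith
    linarith [abs_nonneg (Real.logb 2 κ), abs_nonneg (Real.logb 2 (1 + κ)),
      abs_nonneg (Real.logb 2 (κ / n))]
  · have hlow : 0 ≤ Real.logb 2 (1 + κ * x) := Real.logb_nonneg one_lt_two (by linarith)
    have hlt : Real.logb 2 (p * (κ / n)) ≤ 1 + Real.logb 2 κ + Real.logb 2 a := by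
      rw [← h22, ← Real.logb_mul two_ne_zero hκ.ne', ← Real.logb_mul (by positivity) ha.ne']
      refine Real.logb_le_logb_of_le one_lt_two (by positivity) ?_
      have := mul_le_mul_of_nonneg_left hlarge.le hκ.le
      have e : p * (κ / n) = 2 * (κ * (p / n / 2)) := by ring
      linarith
    linarith [abs_nonneg (Real.logb 2 (1 + κ)), abs_nonneg (Real.logb 2 (κ / n))]

theorem tendsto_logb_one_add_sub {κ n : ℝ} (hκ : 0 < κ) (hn : 0 < n) {x : ℝ → ℝ}
    (hx : Tendsto (fun p => x p / p) atTop (𝓝 (1 / n))) :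
    Tendsto (fun p => Real.logb 2 (1 + κ * x p) - (Real.logb 2 p + Real.logb 2 (κ / n)))
      atTop (𝓝 0) := by
  have h1 : Tendsto (fun p => 1 / p + κ * (x p / p)) atTop (𝓝 (κ / n)) := by
    have h0 : Tendsto (fun p : ℝ => 1 / p) atTop (𝓝 0) := by
      simpa using tendsto_inv_atTop_zero (𝕜 := ℝ)
    simpa [div_eq_mul_inv] using h0.add (hx.const_mul κ)
  have hpos : 0 < κ / n := by positivity
  have h2 : Tendsto (fun p => Real.logb 2 (1 / p + κ * (x p / p)) - Real.logb 2 (κ / n))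
      atTop (𝓝 0) := by
    unfold Real.logb
    simpa using ((h1.log hpos.ne').div_const (Real.log 2)).sub_const
      (Real.log (κ / n) / Real.log 2)
  refine h2.congr' ?_
  filter_upwards [eventually_gt_atTop 0, h1.eventually_const_lt hpos] with p hp hq
  have e : 1 + κ * x p = p * (1 / p + κ * (x p / p)) := by field_simp
  rw [e, Real.logb_mul hp.ne' hq.ne']
  ring

variable {ι : Type*} [Fintype ι]

/-- The water-filling allocation for the reciprocal gains `a`. -/
noncomputable def waterFill (a : ι → ℝ) (p : ℝ) (i : ι) : ℝ := max 0 (waterLevel a p - a i)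

variable [Nonempty ι]

theorem waterFill_le (a : ι → ℝ) {p : ℝ} (hp : 0 < p) (i : ι) : waterFill a p i ≤ p :=
  (Finset.single_le_sum (f := fun i => max 0 (waterLevel a p - a i))
    (fun _ _ => le_max_left _ _) (Finset.mem_univ i)).trans_eq (sum_waterLevel a hp)

theorem sub_le_waterFill {a : ι → ℝ} (ha : ∀ i, 0 ≤ a i) {p : ℝ} (hp : 0 < p) (i : ι) :
    p / Fintype.card ι - a i ≤ waterFill a p i :=
  (sub_le_sub_right (div_card_le_waterLevel ha hp) _).trans (le_max_right _ _)

theorem tendsto_waterFill_div {a : ι → ℝ} (ha : ∀ i, 0 ≤ a i) (i : ι) :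
    Tendsto (fun p => waterFill a p i / p) atTop (𝓝 (1 / Fintype.card ι)) := by
  have hc : (0 : ℝ) < Fintype.card ι := by exact_mod_cast Fintype.card_pos
  have hdiv : ∀ t : ℝ, Tendsto (fun p : ℝ => 1 / (Fintype.card ι : ℝ) + t / p) atTop
      (𝓝 (1 / Fintype.card ι)) := fun t => by
    simpa using ((tendsto_const_nhds (x := t)).div_atTop tendsto_id).const_add
      (1 / (Fintype.card ι : ℝ))
  refine tendsto_of_tendsto_of_tendsto_of_le_of_le' (hdiv (-a i))
    (hdiv ((∑ j, a j) / Fintype.card ι)) ?_ ?_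
  · filter_upwards [eventually_gt_atTop 0] with p hp
    rw [le_div_iff₀ hp]
    refine le_trans (le_of_eq ?_) (sub_le_waterFill ha hp i)
    field_simp
    ring
  · filter_upwards [eventually_gt_atTop 0] with p hp
    rw [div_le_iff₀ hp]
    have hs : 0 ≤ ∑ j, a j := Finset.sum_nonneg fun j _ => ha j
    have h1 : waterFill a p i ≤ (p + ∑ j, a j) / Fintype.card ι :=
      max_le (by positivity) (by linarith [waterLevel_le a p, ha i])
    refine h1.trans_eq ?_
    field_simp

end HighSNR

/-! ### Averaging the water-filling rates over the channel. -/

namespace ISAC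

section Average

variable {Ω : Type*} [MeasurableSpace Ω] {μ : Measure Ω} {M K : ℕ}
  {H : Fin M → Ω → Matrix (Fin K) (Fin M) ℂ} {U : Matrix (Fin M) (Fin M) ℂ}

/-- The water-filling allocation for the gains `ρ`. -/
noncomputable def commAllocation (ρ : Fin M → ℝ) (p : ℝ) : Fin M → ℝ := waterFill (fun m => 1 / ρ m) p

theorem IsCommOptimal.eq_commAllocation (hM : 0 < M) {ρ : Fin M → ℝ} (hρ : ∀ m, 0 < ρ m)
    {p : ℝ} (hp : 0 < p) {c : Fin M → ℝ} (h : IsCommOptimal ρ p c) : c = commAllocation ρ p := by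
  obtain ⟨w, -, hw⟩ := h.eq_max hM hρ hp
  have hsum := h.sum_eq hM hρ
  simp only [hw] at hsum
  funext m
  rw [hw m, commAllocation, waterFill, waterLevel_eq hp hsum]

theorem IsRayleigh.ae_gains_pos [IsProbabilityMeasure μ] (hH : IsRayleigh H μ) (hK : M ≤ K)
    (hU : U ∈ Matrix.unitaryGroup (Fin M) ℂ) :
    ∀ᵐ ω ∂μ, ∀ m, 0 < gains (fun m => H m ω) U m := by
  rw [ae_all_iff]
  intro m
  obtain ⟨b, -, hb⟩ := hH.exists_integrable_bound hK hU m
  filter_upwards [hb] with ω hω using hω.1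

theorem IsRayleigh.aemeasurable_commAllocation (hH : IsRayleigh H μ)
    (U : Matrix (Fin M) (Fin M) ℂ) (p : ℝ) (m : Fin M) :
    AEMeasurable (fun ω => commAllocation (gains (fun m => H m ω) U) p m) μ := by
  have ha : ∀ m, AEMeasurable (fun ω => 1 / gains (fun m => H m ω) U m) μ := fun m =>
    (hH.aemeasurable_gains U m).const_div 1
  exact aemeasurable_const.max
    ((aemeasurable_waterLevel (a := fun ω m => 1 / gains (fun m => H m ω) U m) ha p).sub (ha m))

/-- The rate `log₂ (1 + κ c_m)` of the allocation to user `m`, as a function of the channel. -/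
theorem IsRayleigh.aestronglyMeasurable_logb (hH : IsRayleigh H μ) (U : Matrix (Fin M) (Fin M) ℂ)
    (κ p : ℝ) (m : Fin M) :
    AEStronglyMeasurable (fun ω =>
      Real.logb 2 (1 + κ * commAllocation (gains (fun m => H m ω) U) p m)) μ := by
  unfold Real.logb
  exact ((Real.measurable_log.comp_aemeasurable
    (((hH.aemeasurable_commAllocation U p m).const_mul κ).const_add 1)).div_const
      _).aestronglyMeasurable

/-- At fixed `p` the allocation lies in `[0, p]` for every channel, so the rate is bounded. -/
theorem IsRayleigh.integrable_logb [IsProbabilityMeasure μ] (hH : IsRayleigh H μ) (U : Matrix (Fin M) (Fin M) ℂ)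
    {κ p : ℝ} (hκ : 0 < κ) (hp : 0 < p) (m : Fin M) :
    Integrable (fun ω =>
      Real.logb 2 (1 + κ * commAllocation (gains (fun m => H m ω) U) p m)) μ := by
  have : Nonempty (Fin M) := ⟨m⟩
  refine Integrable.of_bound (hH.aestronglyMeasurable_logb U κ p m) (Real.logb 2 (1 + κ * p))
    (ae_of_all _ fun ω => ?_)
  have h0 : 0 ≤ commAllocation (gains (fun m => H m ω) U) p m := le_max_left _ _
  have h1 : commAllocation (gains (fun m => H m ω) U) p m ≤ p := waterFill_le _ hp m
  have h2 := mul_nonneg hκ.le h0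
  rw [Real.norm_of_nonneg (Real.logb_nonneg one_lt_two (by linarith))]
  refine Real.logb_le_logb_of_le one_lt_two (by linarith) ?_
  gcongr

/-- Dominated convergence: `abs_logb_one_add_sub_le` with `a = 1/ρ_m` yields an integrable majorant
valid for all `p ≥ 1`. -/
theorem IsRayleigh.tendsto_integral_logb [IsProbabilityMeasure μ] (hH : IsRayleigh H μ) (hK : M ≤ K)
    (hU : U ∈ Matrix.unitaryGroup (Fin M) ℂ) {κ : ℝ} (hκ : 0 < κ) (m : Fin M) :
    Tendsto (fun p => (∫ ω, Real.logb 2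
        (1 + κ * commAllocation (gains (fun m => H m ω) U) p m) ∂μ) -
          (Real.logb 2 p + Real.logb 2 (κ / M))) atTop (𝓝 0) := by
  have : Nonempty (Fin M) := ⟨m⟩
  have hMR : (0 : ℝ) < M := by exact_mod_cast m.pos
  obtain ⟨b, hbint, hb⟩ := hH.exists_integrable_bound hK hU m
  have hpos := hH.ae_gains_pos hK hU
  have key : Tendsto (fun p => ∫ ω, (Real.logb 2
      (1 + κ * commAllocation (gains (fun m => H m ω) U) p m) -
        (Real.logb 2 p + Real.logb 2 (κ / M))) ∂μ) atTop (𝓝 (∫ _ω, (0 : ℝ) ∂μ)) := by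
    refine tendsto_integral_filter_of_dominated_convergence (fun ω =>
      1 + |Real.logb 2 (1 + κ)| + |Real.logb 2 (κ / M)| + |Real.logb 2 κ| + b ω / Real.log 2)
      (Eventually.of_forall fun p =>
        (hH.aestronglyMeasurable_logb U κ p m).sub aestronglyMeasurable_const) ?_
      ((integrable_const _).add (hbint.div_const _)) ?_
    · filter_upwards [eventually_ge_atTop 1] with p hp
      have hp0 : 0 < p := by linarith
      filter_upwards [hb, hpos] with ω hω hω'
      have ha : ∀ m, 0 ≤ 1 / gains (fun m => H m ω) U m := fun m => (one_div_pos.2 (hω' m)).le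
      have hsub := sub_le_waterFill ha hp0 m
      rw [Fintype.card_fin] at hsub
      exact abs_logb_one_add_sub_le hκ hMR hp (le_max_left _ _) (waterFill_le _ hp0 m) hsub
        (one_div_pos.2 hω.1) hω.2.1 hω.2.2
    · filter_upwards [hpos] with ω hω
      refine tendsto_logb_one_add_sub hκ hMR ?_
      have := tendsto_waterFill_div (fun m => (one_div_pos.2 (hω m)).le) m
      rwa [Fintype.card_fin] at this
  rw [integral_zero] at key
  refine key.congr' ?_
  filter_upwards [eventually_gt_atTop 0] with p hp
  rw [integral_sub (hH.integrable_logb U hκ hp m) (integrable_const _)]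
  simp

end Average

end ISAC

theorem theorem6 {Ω : Type*} [MeasurableSpace Ω] (μ : Measure Ω) [IsProbabilityMeasure μ]
    (M N K L : ℕ) (hM : 0 < M) (hL : 0 < L) (hK : M ≤ K)
    -- the channels
    (H : Fin M → Ω → Matrix (Fin K) (Fin M) ℂ) (hH : ISAC.IsRayleigh H μ)
    -- the target correlation matrix and its eigendecomposition
    (R U : Matrix (Fin M) (Fin M) ℂ) (lam : Fin M → ℝ) (hR : R.PosDef)
    (hU : U ∈ Matrix.unitaryGroup (Fin M) ℂ)
    (hED : R = U * Matrix.diagonal (fun m => (lam m : ℂ)) * Uᴴ)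
    -- the communications-centric power allocation for each budget and channel realization
    (c : ℝ → Ω → Fin M → ℝ)
    (hc : ∀ p : ℝ, 0 < p → ∀ᵐ ω ∂μ,
      ISAC.IsCommOptimal (ISAC.gains (fun m => H m ω) U) p (c p ω)) :
    -- the allocation is given by water-filling
    (∀ p : ℝ, 0 < p → ∀ᵐ ω ∂μ,
      (∃ υ : ℝ, 0 < υ ∧
        ∀ m, c p ω m = max 0 (1 / υ - 1 / ISAC.gains (fun m => H m ω) U m)) ∧
      ∑ m, c p ω m = p) ∧
    -- the sensing rate of the resulting precoding matrix
    (∀ p : ℝ, 0 < p → ∀ᵐ ω ∂μ,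
      ISAC.sensingRate N L R (ISAC.precoder U (c p ω)) =
        (N : ℝ) / L * ∑ m, Real.logb 2 (1 + (L : ℝ) * lam m * c p ω m)) ∧
    -- its average exists and has the stated high-SNR behaviour
    (∀ p : ℝ, 0 < p →
      Integrable (fun ω => ISAC.sensingRate N L R (ISAC.precoder U (c p ω))) μ) ∧
    Tendsto
      (fun p : ℝ => (∫ ω, ISAC.sensingRate N L R (ISAC.precoder U (c p ω)) ∂μ) -
        ISAC.highSNRSensingRate N L lam p)
      atTop (𝓝 0) ∧
    -- the sensing-centric optimum is attained and has the same high-SNR behaviour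
    (∀ p : ℝ, 0 < p →
      IsGreatest (ISAC.achievableSensingRates N L R p) (ISAC.maxSensingRate N L R p)) ∧
    Tendsto
      (fun p : ℝ => ISAC.maxSensingRate N L R p - ISAC.highSNRSensingRate N L lam p)
      atTop (𝓝 0) := by
  have hlam := ISAC.eigenvalue_pos hR hU hED
  have hLR : (0 : ℝ) < L := by exact_mod_cast hL
  have hpos := hH.ae_gains_pos hK hU
  have hrate : ∀ p : ℝ, 0 < p → ∀ᵐ ω ∂μ,
      ISAC.sensingRate N L R (ISAC.precoder U (c p ω)) =
        (N : ℝ) / L * ∑ m, Real.logb 2 (1 + (L : ℝ) * lam m * c p ω m) := by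
    intro p hp
    filter_upwards [hc p hp] with ω hω
    exact ISAC.sensingRate_precoder N L hU hED hlam hω.1.1
  -- The selection `c` need not be measurable; uniqueness of the maximizer replaces it almost surely
  -- by an a.e. measurable function of the channel.
  have hrate' : ∀ p : ℝ, 0 < p →
      (fun ω => ISAC.sensingRate N L R (ISAC.precoder U (c p ω))) =ᵐ[μ] fun ω =>
        (N : ℝ) / L * ∑ m, Real.logb 2 (1 + (L : ℝ) * lam m *
          ISAC.commAllocation (ISAC.gains (fun m => H m ω) U) p m) := by
    intro p hp
    filter_upwards [hrate p hp, hc p hp, hpos] with ω hω hω' hω''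
    rw [hω, ← hω'.eq_commAllocation hM hω'' hp]
  have hκ : ∀ m, 0 < (L : ℝ) * lam m := fun m => mul_pos hLR (hlam m)
  refine ⟨fun p hp => ?_, hrate, fun p hp => ?_, ?_,
    fun p hp => ISAC.isGreatest_maxSensingRate N L hR hp.le,
    ISAC.tendsto_maxSensingRate_sub hM N hL hR hU hED⟩
  · filter_upwards [hc p hp, hpos] with ω hω hω'
    obtain ⟨w, hw, hcw⟩ := hω.eq_max hM hω' hp
    exact ⟨⟨1 / w, one_div_pos.2 hw, by simpa using hcw⟩, hω.sum_eq hM hω'⟩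
  · refine (integrable_congr (hrate' p hp)).2 ?_
    exact (integrable_finsetSum _ fun m _ => hH.integrable_logb U (hκ m) hp m).const_mul _
  · have hlim := (tendsto_finsetSum Finset.univ fun m _ =>
      hH.tendsto_integral_logb hK hU (hκ m) m).const_mul ((N : ℝ) / L)
    rw [Finset.sum_const_zero, mul_zero] at hlim
    refine hlim.congr' ?_
    filter_upwards [eventually_gt_atTop 0] with p hp
    rw [integral_congr_ae (hrate' p hp), integral_const_mul,
      integral_finsetSum _ fun m _ => hH.integrable_logb U (hκ m) hp m,
      ISAC.highSNRSensingRate_eq hM, ← mul_sub, ← Finset.sum_sub_distrib]
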